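/- For $d\ge 2$ let $S^{d-1}\subset\mathbb{R}^d$ be the unit sphere and $P^{d-1}=\{(y,|y|^2): y\in\mathbb{R}^{d-1},\ |y|\le 1\}$ the truncated unit paraboloid. For $S\in\{S^{d-1},P^{d-1}\}$ with surface measure $\mathrm{d}\sigma_S$ let $E_S f(x)=\int_S f(\xi)\,e^{2\pi i x\cdot\xi}\,\mathrm{d}\sigma_S(\xi)$ be the Fourier extension operator. For $\beta\ge 0$ and $R>1$ let $$X_d=\bigl((R^{\beta}\mathbb{Z})^{d-1}\times R^{2\beta}\mathbb{Z}\bigr)\cap[-R,R]^d ,$$ and let $\|E_S\|_{L^2(\mathrm{d}\sigma_S)\to l^2(X_d)}$ be the operator norm, that is, the supremum of $\bigl(\sum_{x\in X_d}|E_Sf(x)|^2\bigr)^{1/2}$ over all $f$ with $\|f\|_{L^2(\mathrm{d}\sigma_S)}\le 1$. (i) There is an absolute constant $c>0$ such that for every $d\ge 2$ and every $\varepsilon>0$ there is a constant $C_{d,\varepsilon}>0$ such that, for all $0\le\beta\le c/d^2$ and all $R>1$, $$\|E_{S^{d-1}}\|_{L^2(\mathrm{d}\sigma_{S^{d-1}})\to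 l^2(X_d)}\le C_{d,\varepsilon}\,R^{\frac12-\frac32\beta+\varepsilon}.$$ (ii) In contrast, for every $d\ge 2$ there is a constant $C_d>0$ such that, for all $0\le\beta\le\frac12$ and all $R>1$, $$\|E_{P^{d-1}}\|_{L^2(\mathrm{d}\sigma_{P^{d-1}})\to l^2(X_d)}\ge C_d\,R^{\frac12-\beta}.$$ -/

import Mathlib

open MeasureTheory
open scoped ENNReal

noncomputable section

/-- The Fourier extension `E_σ f (x) = ∫ f(ξ) e^{2πi x·ξ} dσ(ξ)` of `f` with respect to a
measure `σ` on `ℝ^d` (for us, the surface measure of a compact hypersurface). -/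
def fourierExtension {d : ℕ} (σ : Measure (EuclideanSpace ℝ (Fin d)))
    (f : EuclideanSpace ℝ (Fin d) → ℂ) (x : EuclideanSpace ℝ (Fin d)) : ℂ :=
  ∫ ξ, f ξ * Complex.exp (2 * Real.pi * Complex.I * ((inner ℝ x ξ : ℝ) : ℂ)) ∂σ

/-- The `l²(X)` norm of a function on `ℝ^d`, as an extended nonnegative real. -/
def l2NormOn {d : ℕ} (X : Set (EuclideanSpace ℝ (Fin d)))
    (g : EuclideanSpace ℝ (Fin d) → ℂ) : ℝ≥0∞ :=
  (∑' x : X, ‖g x‖ₑ ^ 2) ^ (1 / 2 : ℝ)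

/-- The operator norm `‖E_σ‖_{L²(dσ) → l²(X)}`: the supremum of `‖E_σ f‖_{l²(X)}` over the unit
ball of `L²(dσ)`. -/
def extensionNorm {d : ℕ} (σ : Measure (EuclideanSpace ℝ (Fin d)))
    (X : Set (EuclideanSpace ℝ (Fin d))) : ℝ≥0∞ :=
  ⨆ (f : EuclideanSpace ℝ (Fin d) → ℂ) (_ : MemLp f 2 σ) (_ : eLpNorm f 2 σ ≤ 1),
    l2NormOn X (fourierExtension σ f)

/-- The surface measure of the unit sphere `S^{d-1}`, as a measure on `ℝ^d`. -/
def sphereMeasure (d : ℕ) : Measure (EuclideanSpace ℝ (Fin d)) :=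
  ((volume : Measure (EuclideanSpace ℝ (Fin d))).toSphere).map Subtype.val

/-- The graph parametrization `y ↦ (y, |y|²)` of the paraboloid in `ℝ^d`, `y ∈ ℝ^{d-1}`. -/
def paraboloidMap (d : ℕ) (y : EuclideanSpace ℝ (Fin (d - 1))) : EuclideanSpace ℝ (Fin d) :=
  WithLp.toLp 2 fun i : Fin d => if h : (i : ℕ) < d - 1 then y ⟨i, h⟩ else ‖y‖ ^ 2

/-- The surface measure of the truncated unit paraboloid `P^{d-1} = {(y, |y|²) : |y| ≤ 1}`, as a
measure on `ℝ^d`. The surface area element of the graph of `y ↦ |y|²` is `√(1 + 4|y|²) dy`. -/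
def paraboloidMeasure (d : ℕ) : Measure (EuclideanSpace ℝ (Fin d)) :=
  (((volume : Measure (EuclideanSpace ℝ (Fin (d - 1)))).restrict
    (Metric.closedBall 0 1)).withDensity
      fun y => ENNReal.ofReal (Real.sqrt (1 + 4 * ‖y‖ ^ 2))).map (paraboloidMap d)

/-- The set `X_d = (R^β ℤ × ⋯ × R^β ℤ × R^{2β} ℤ) ∩ [-R, R]^d`, the exponent `2β` being that of the
last coordinate. -/
def latticeBox (d : ℕ) (β R : ℝ) : Set (EuclideanSpace ℝ (Fin d)) :=
  {x | (∀ i : Fin d, ∃ m : ℤ,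
      x i = (m : ℝ) * (if (i : ℕ) < d - 1 then R ^ β else R ^ (2 * β))) ∧
    ∀ i : Fin d, |x i| ≤ R}

end

/-! Write `N = R ^ β`, so that the dual lattice of the frequencies is N⁻¹ℤ × ⋯ × N⁻¹ℤ × N⁻²ℤ.

Sphere. By duality (`extensionNorm_le_of_dual`) it suffices to bound the L²(dσ) norm of exponential
sums with frequencies in X_d by the l² norm of their coefficients. The frequencies are at most R, so
such a sum is essentially constant on cubes of side about 1/R, and σ may be smeared out at that
scale. The sum is also periodic under the dual lattice. Folding the smeared integral into one period
cell and applying Parseval leaves only the σ-mass of a family of small cubes centred on a translate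
of the dual lattice (`lintegral_trigPoly_le`). Each cube has mass O(R^{-(d-1)}), so the problem is
to show that O(N^{d-2} R^ε) points of the translate lie within 1/R of the sphere. The normalising
volume is about R^{-d} N^{d+1}; the squared norm is then O(R N^{-3} R^ε), which is the claimed
exponent.

The count is arithmetic. Freezing d - 2 coordinates costs N^{d-2} and leaves points of N⁻¹ℤ × N⁻²ℤ
near a circle. As R ≥ N^200, the width 1/R is far below any resolution set by N: simultaneous
Diophantine approximation of the coefficients turns near-incidence into an exact integral equation
with coefficients polynomial in N (`exists_card_near_circle_le`). Completing squares gives X² + D Y²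
= M, whose solutions are controlled by the divisor function (`card_repr_le`), hence are O(R^ε) in
number.

Paraboloid. If y has coordinates in N⁻¹ℤ, then (y, |y|²) lies in the dual lattice itself, so all
phases x · ξ are integers. Testing with the indicator of neighbourhoods of these points of size
about 1/R, of mass about (N/R)^{d-1}, there is no cancellation at about R^d / N^{d+1} points x. The
product R / N² is the square of the claimed bound. -/

/-! ### The divisor bound -/

/-- The divisor bound: the number of divisors of `n` is `O(n ^ ε)` for every `ε > 0`. -/
theorem exists_card_divisors_le_rpow {ε : ℝ} (hε : 0 < ε) :
    ∃ C : ℝ, 1 ≤ C ∧ ∀ n : ℕ, n ≠ 0 → (n.divisors.card : ℝ) ≤ C * (n : ℝ) ^ ε := by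
  obtain ⟨P, hP⟩ := exists_nat_ge ((2 : ℝ) ^ (1 / ε))
  -- With L = ε log 2, this K gives a + 1 ≤ K (1 + L a) ≤ K · 2^{εa} for every a.
  set K : ℝ := 1 + 1 / (ε * Real.log 2) with hK
  have hlog : 0 < Real.log 2 := Real.log_pos (by norm_num)
  have hK1 : 1 ≤ K := by
    have : 0 < 1 / (ε * Real.log 2) := by positivity
    linarith
  -- Only primes below P ≥ 2^{1/ε} cost a factor K. For the others p^ε ≥ 2, and a + 1 ≤ 2^a
  -- suffices.
  have hbase : ∀ (p a : ℕ), p.Prime →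
      ((a : ℝ) + 1) ≤ (if p ∈ Finset.range P then K else 1) * ((p : ℝ) ^ a) ^ ε := by
    intro p a hp
    have hp2 : (2 : ℝ) ≤ p := by exact_mod_cast hp.two_le
    have hcomm : ((p : ℝ) ^ a) ^ ε = ((p : ℝ) ^ ε) ^ a := by
      rw [← Real.rpow_natCast, ← Real.rpow_natCast, ← Real.rpow_mul (by positivity),
        ← Real.rpow_mul (by positivity), mul_comm]
    split_ifs with h
    · have h1 : (2 : ℝ) ^ (ε * a) ≤ ((p : ℝ) ^ a) ^ ε := by
        rw [hcomm, Real.rpow_mul (by norm_num), Real.rpow_natCast]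
        gcongr
      have h2 : 1 + ε * a * Real.log 2 ≤ (2 : ℝ) ^ (ε * a) := by
        rw [Real.rpow_def_of_pos (by norm_num)]
        have := Real.add_one_le_exp (Real.log 2 * (ε * a))
        linarith
      have h3 : (a : ℝ) + 1 ≤ K * (1 + ε * a * Real.log 2) := by
        have : K * (1 + ε * a * Real.log 2)
            = 1 + a + ε * a * Real.log 2 + 1 / (ε * Real.log 2) := by
          rw [hK]; field_simp; ring
        rw [this]
        have : 0 ≤ ε * a * Real.log 2 := by positivity
        have : 0 ≤ 1 / (ε * Real.log 2) := by positivity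
        linarith
      exact h3.trans (mul_le_mul_of_nonneg_left (h2.trans h1) (by linarith))
    · have hPp : (P : ℝ) ≤ p := by
        simp only [Finset.mem_range, not_lt] at h
        exact_mod_cast h
      have h1 : (2 : ℝ) ≤ (p : ℝ) ^ ε := by
        calc (2 : ℝ) = ((2 : ℝ) ^ (1 / ε)) ^ ε := by
              rw [← Real.rpow_mul (by norm_num), one_div_mul_cancel hε.ne', Real.rpow_one]
          _ ≤ (p : ℝ) ^ ε := Real.rpow_le_rpow (by positivity) (hP.trans hPp) hε.le
      rw [hcomm, one_mul]
      have h2 : ((a : ℝ) + 1) ≤ 2 ^ a := by exact_mod_cast Nat.lt_two_pow_self (n := a)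
      exact h2.trans (by gcongr)
  refine ⟨K ^ P, one_le_pow₀ hK1, fun n hn => ?_⟩
  rw [Nat.card_divisors hn]
  push_cast
  calc ∏ p ∈ n.primeFactors, ((n.factorization p : ℝ) + 1)
      ≤ ∏ p ∈ n.primeFactors, (if p ∈ Finset.range P then K else 1) *
          ((p : ℝ) ^ n.factorization p) ^ ε := by
        refine Finset.prod_le_prod (fun _ _ => by positivity) fun p hp => ?_
        exact hbase p _ (Nat.prime_of_mem_primeFactors hp)
    _ = (∏ p ∈ n.primeFactors, (if p ∈ Finset.range P then K else 1)) * (n : ℝ) ^ ε := by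
        rw [Finset.prod_mul_distrib, Real.finsetProd_rpow _ _ (fun _ _ => by positivity)]
        congr 2
        have := Nat.prod_factorization_pow_eq_self hn
        conv_rhs => rw [← this]
        rw [Finsupp.prod]
        push_cast
        rfl
    _ ≤ K ^ P * (n : ℝ) ^ ε := by
        gcongr
        rw [Finset.prod_ite_mem, Finset.prod_const]
        refine pow_le_pow_right₀ hK1 ?_
        exact (Finset.card_le_card Finset.inter_subset_right).trans (by simp)

/-! ### Representations of an integer by X² + D Y² -/

theorem dvd_of_dvd_of_eq {t a b : ℤ} (h : t ∣ a) (hab : b = a) : t ∣ b := hab ▸ h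

/-- For squarefree `D`, two primitive representations of `M` by `X² + D Y²` that have the same
`gcd (X Y' - X' Y, M)` with a fixed third one are congruent up to a factor `2`. -/
theorem dvd_two_mul_det_of_gcd_eq {D M X Y X₁ Y₁ X₂ Y₂ : ℤ} (hD : Squarefree D) (hM : 0 < M)
    (h : X ^ 2 + D * Y ^ 2 = M) (hc : IsCoprime X Y)
    (h₁ : X₁ ^ 2 + D * Y₁ ^ 2 = M) (hc₁ : IsCoprime X₁ Y₁)
    (h₂ : X₂ ^ 2 + D * Y₂ ^ 2 = M)
    (he : Int.gcd (X * Y₁ - X₁ * Y) M = Int.gcd (X * Y₂ - X₂ * Y) M) :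
    M ∣ 2 * (X₁ * Y₂ - X₂ * Y₁) := by
  set e : ℤ := (Int.gcd (X * Y₁ - X₁ * Y) M : ℤ) with he1
  have he2 : e = (Int.gcd (X * Y₂ - X₂ * Y) M : ℤ) := by rw [he1, he]
  have heM : e ∣ M := Int.gcd_dvd_right _ _
  obtain ⟨h', hh'⟩ := heM
  have hepos : 0 < e := by
    rw [he1]; exact_mod_cast Int.gcd_pos_of_ne_zero_right _ hM.ne'
  -- The product (XW - ZY)(XW + ZY) equals M (W² - Y²). Since e is the exact gcd of the first factor
  -- with M, the complementary divisor `h'` = M / e must divide the second.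
  have hB : ∀ Z W : ℤ, Z ^ 2 + D * W ^ 2 = M → e = (Int.gcd (X * W - Z * Y) M : ℤ) →
      e ∣ X * W - Z * Y ∧ h' ∣ X * W + Z * Y := by
    intro Z W hZ heq
    have hdA : e ∣ X * W - Z * Y := heq ▸ Int.gcd_dvd_left _ _
    refine ⟨hdA, ?_⟩
    obtain ⟨a, ha⟩ := hdA
    have hcop : IsCoprime h' a := by
      rw [Int.isCoprime_iff_gcd_eq_one]
      have h3 : (Int.gcd (e * a) (e * h') : ℤ) = e := by rw [← ha, ← hh', ← heq]
      rw [Int.gcd_mul_left] at h3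
      push_cast at h3
      rw [abs_of_pos hepos] at h3
      have h4 : (Int.gcd a h' : ℤ) = 1 := by
        have : e * (Int.gcd a h' : ℤ) = e * 1 := by linarith
        exact mul_left_cancel₀ hepos.ne' this
      rw [Int.gcd_comm]
      exact_mod_cast h4
    have hprod : M ∣ (X * W - Z * Y) * (X * W + Z * Y) :=
      ⟨W ^ 2 - Y ^ 2, by
        have e1 : X ^ 2 = M - D * Y ^ 2 := by linarith
        have e2 : Z ^ 2 = M - D * W ^ 2 := by linarith
        linear_combination W ^ 2 * e1 - Y ^ 2 * e2⟩
    rw [ha, hh', mul_assoc] at hprod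
    exact hcop.dvd_of_dvd_mul_left ((mul_dvd_mul_iff_left hepos.ne').1 hprod)
  obtain ⟨hA1, hB1⟩ := hB X₁ Y₁ h₁ he1
  obtain ⟨hA2, hB2⟩ := hB X₂ Y₂ h₂ he2
  have hcomb : ∀ t : ℤ, t ∣ X * (X₁ * Y₂ - X₂ * Y₁) → t ∣ Y * (X₁ * Y₂ - X₂ * Y₁) →
      t ∣ X₁ * Y₂ - X₂ * Y₁ := by
    intro t hX hY
    obtain ⟨u, v, huv⟩ := hc
    have := dvd_add (hX.mul_left u) (hY.mul_left v)
    have h5 : u * (X * (X₁ * Y₂ - X₂ * Y₁)) + v * (Y * (X₁ * Y₂ - X₂ * Y₁))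
      = X₁ * Y₂ - X₂ * Y₁ := by
      linear_combination (X₁ * Y₂ - X₂ * Y₁) * huv
    rwa [h5] at this
  -- X and Y times the determinant are integer combinations of the two differences (for e) or of the
  -- two sums (for `h'`), and X, Y are coprime.
  have heW : e ∣ X₁ * Y₂ - X₂ * Y₁ := by
    refine hcomb e ?_ ?_
    · exact (dvd_of_dvd_of_eq (dvd_sub (hA2.mul_left X₁) (hA1.mul_left X₂)) (by ring))
    · exact (dvd_of_dvd_of_eq (dvd_sub (hA2.mul_left Y₁) (hA1.mul_left Y₂)) (by ring))
  have hhW : h' ∣ X₁ * Y₂ - X₂ * Y₁ := by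
    refine hcomb h' ?_ ?_
    · exact (dvd_of_dvd_of_eq (dvd_sub (hB2.mul_left X₁) (hB1.mul_left X₂)) (by ring))
    · exact (dvd_of_dvd_of_eq (dvd_sub (hB1.mul_left Y₂) (hB2.mul_left Y₁)) (by ring))
  -- no prime `p` with `p² ∣ M` divides both cross terms
  have key : ∀ p : ℤ, Prime p → p ^ 2 ∣ M → p ∣ X * Y₁ → p ∣ X₁ * Y → False := by
    intro p hp hpM h6 h7
    have hpM' : p ∣ M := (dvd_pow_self p two_ne_zero).trans hpM
    have bad : ∀ Z W : ℤ, IsCoprime Z W → p ∣ Z → p ∣ W → False := fun Z W hZW hZ hW =>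
      hp.not_isUnit (hZW.isUnit_of_dvd' hZ hW)
    have hYX : ∀ Z W : ℤ, Z ^ 2 + D * W ^ 2 = M → IsCoprime Z W → ¬ p ∣ W := by
      intro Z W hZ hZW hW
      refine bad Z W hZW ?_ hW
      refine hp.dvd_of_dvd_pow (n := 2) ?_
      have : Z ^ 2 = M - D * W ^ 2 := by linarith
      rw [this]
      exact dvd_sub hpM' ((dvd_pow hW two_ne_zero).mul_left D)
    rcases hp.dvd_or_dvd h6 with h8 | h8
    · have hYn := hYX X Y h hc
      have h9 : p ^ 2 ∣ D * Y ^ 2 := by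
        have : D * Y ^ 2 = M - X ^ 2 := by linarith
        rw [this]
        exact dvd_sub hpM (pow_dvd_pow_of_dvd h8 2)
      have h10 : IsCoprime (p ^ 2) (Y ^ 2) := by
        refine IsCoprime.pow ?_
        exact (hp.coprime_iff_not_dvd).2 hYn
      have h11 := h10.dvd_of_dvd_mul_right h9
      rw [sq] at h11
      exact hp.not_isUnit (hD p h11)
    · exact hYX X₁ Y₁ h₁ hc₁ h8
  -- The gcd divides both the sum and the difference of the cross terms, hence twice each of them. A
  -- prime of the gcd has its square dividing M = e `h'`, so `key` excludes it once a possible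
  -- factor 2 is removed. Then M = gcd · lcm divides twice the determinant.
  have hg : (Int.gcd e h' : ℤ) ∣ 2 := by
    set g : ℤ := (Int.gcd e h' : ℤ) with hgdef
    have hge : g ∣ e := Int.gcd_dvd_left _ _
    have hgh : g ∣ h' := Int.gcd_dvd_right _ _
    have hgA : g ∣ X * Y₁ - X₁ * Y := hge.trans hA1
    have hgB : g ∣ X * Y₁ + X₁ * Y := hgh.trans hB1
    have hs : g ∣ 2 * (X * Y₁) := by
      exact (dvd_of_dvd_of_eq (dvd_add hgA hgB) (by ring))
    have hd : g ∣ 2 * (X₁ * Y) := by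
      exact (dvd_of_dvd_of_eq (dvd_sub hgB hgA) (by ring))
    have hg2 : ∀ p : ℤ, p ∣ g → p ^ 2 ∣ M := fun p hp => by
      rw [hh', sq]; exact mul_dvd_mul (hp.trans hge) (hp.trans hgh)
    have hg0 : g ≠ 0 := by
      rw [hgdef]
      exact_mod_cast (Int.gcd_pos_of_ne_zero_left _ hepos.ne').ne'
    by_cases h2g : (2 : ℤ) ∣ g
    · obtain ⟨t, ht⟩ := h2g
      have hts : t ∣ X * Y₁ := by
        rw [ht] at hs; exact (mul_dvd_mul_iff_left two_ne_zero).1 hs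
      have htd : t ∣ X₁ * Y := by
        rw [ht] at hd; exact (mul_dvd_mul_iff_left two_ne_zero).1 hd
      have htu : IsUnit t := by
        by_contra hnu
        obtain ⟨p, hp, hpt⟩ := WfDvdMonoid.exists_irreducible_factor hnu
          (by rintro rfl; simp at ht; exact hg0 ht)
        exact key p hp.prime (hg2 p (hpt.trans ⟨2, by rw [ht]; ring⟩)) (hpt.trans hts)
          (hpt.trans htd)
      rw [ht]
      simpa using mul_dvd_mul_left 2 (htu.dvd (a := 1))
    · have h2p : IsCoprime g 2 := ((Int.prime_two.coprime_iff_not_dvd).2 h2g).symm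
      have htu : IsUnit g := by
        by_contra hnu
        obtain ⟨p, hp, hpt⟩ := WfDvdMonoid.exists_irreducible_factor hnu hg0
        exact key p hp.prime (hg2 p hpt) (hpt.trans (h2p.dvd_of_dvd_mul_left hs))
          (hpt.trans (h2p.dvd_of_dvd_mul_left hd))
      exact htu.dvd
  obtain ⟨k, hk⟩ := hg
  have hlcm : (Int.lcm e h' : ℤ) ∣ X₁ * Y₂ - X₂ * Y₁ := Int.coe_lcm_dvd heW hhW
  have hgl : (Int.gcd e h' : ℤ) * (Int.lcm e h' : ℤ) = |M| := by
    rw [hh', abs_mul]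
    have := Int.gcd_mul_lcm e h'
    zify at this
    rw [this]
  rw [abs_of_pos hM] at hgl
  rw [← hgl, hk, mul_assoc]
  exact mul_dvd_mul_left _ (hlcm.mul_left k)

/-- Solutions are sorted by the divisor gcd(XY' - X'Y, M) attached to a fixed solution (X, Y).
Within a class, compare with one member (X₁, Y₁): the identity (X₁X₂ + DY₁Y₂)² + D (X₁Y₂ - X₂Y₁)² =
M² bounds the determinant by M, while 2 · determinant is a multiple of M, leaving five values. The
determinant fixes the other term up to sign, and the two together recover (X₂, Y₂). -/
theorem card_primitive_repr_le {D M : ℤ} (hD : Squarefree D) (hD0 : 0 < D) (hM : 0 < M)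
    (S : Finset (ℤ × ℤ))
    (hS : ∀ P ∈ S, P.1 ^ 2 + D * P.2 ^ 2 = M ∧ IsCoprime P.1 P.2) :
    S.card ≤ 15 * M.natAbs.divisors.card := by
  classical
  rcases S.eq_empty_or_nonempty with rfl | ⟨⟨X, Y⟩, h0⟩
  · simp
  obtain ⟨h, hc⟩ := hS _ h0
  simp only at h hc
  refine Finset.card_le_mul_card_image_of_maps_to
    (f := fun P : ℤ × ℤ => Int.gcd (X * P.2 - P.1 * Y) M) ?_ 15 ?_
  · intro P hP
    simp only [Nat.mem_divisors]
    refine ⟨?_, by simpa using hM.ne'⟩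
    have := Int.gcd_dvd_right (X * P.2 - P.1 * Y) M
    rwa [← Int.natCast_dvd]
  · intro e he
    rcases (S.filter (fun P : ℤ × ℤ => Int.gcd (X * P.2 - P.1 * Y) M = e)).eq_empty_or_nonempty
      with h1 | ⟨⟨X₁, Y₁⟩, h1⟩
    · rw [h1]; simp
    rw [Finset.mem_filter] at h1
    obtain ⟨h1S, h1e⟩ := h1
    obtain ⟨h₁, hc₁⟩ := hS _ h1S
    simp only at h₁ hc₁ h1e
    -- Five values of 2 · determinant / M times three values of the sign.
    have hcard : ((Finset.Icc (-2 : ℤ) 2) ×ˢ (Finset.Icc (-1 : ℤ) 1)).card = 15 := by decide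
    rw [← hcard]
    refine Finset.card_le_card_of_injOn (fun P => (2 * (X₁ * P.2 - P.1 * Y₁) / M,
      SignType.cast (SignType.sign (X₁ * P.1 + D * Y₁ * P.2)))) ?_ ?_
    · rintro ⟨X₂, Y₂⟩ hP
      simp only [Finset.coe_filter, Set.mem_ofPred_eq] at hP
      obtain ⟨h₂, -⟩ := hS _ hP.1
      simp only at h₂ hP
      obtain ⟨k, hk⟩ := dvd_two_mul_det_of_gcd_eq hD hM h hc h₁ hc₁ h₂ (h1e.trans hP.2.symm)
      have hid : (X₁ * X₂ + D * Y₁ * Y₂) ^ 2 + D * (X₁ * Y₂ - X₂ * Y₁) ^ 2 = M ^ 2 := by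
        linear_combination (X₂ ^ 2 + D * Y₂ ^ 2) * h₁ + M * h₂
      have hk2 : (M * k) ^ 2 ≤ 4 * M ^ 2 := by
        rw [← hk]; nlinarith [sq_nonneg (X₁ * X₂ + D * Y₁ * Y₂), sq_nonneg (X₁ * Y₂ - X₂ * Y₁)]
      have hk3 : k ^ 2 ≤ 2 ^ 2 := by
        have : 0 < M ^ 2 := by positivity
        nlinarith
      have hk4 := abs_le.1 (abs_le_of_sq_le_sq hk3 (by norm_num))
      simp only [Finset.coe_product, Set.mem_prod, Finset.mem_coe, Finset.mem_Icc]
      refine ⟨?_, ?_⟩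
      · rw [hk, Int.mul_ediv_cancel_left _ hM.ne']; exact hk4
      · rcases SignType.sign (X₁ * X₂ + D * Y₁ * Y₂) <;> simp
    · rintro ⟨X₂, Y₂⟩ hP ⟨X₃, Y₃⟩ hQ hPQ
      simp only [Finset.coe_filter, Set.mem_ofPred_eq] at hP hQ
      obtain ⟨h₂, -⟩ := hS _ hP.1
      obtain ⟨h₃, -⟩ := hS _ hQ.1
      simp only at h₂ hP h₃ hQ
      have d2 := dvd_two_mul_det_of_gcd_eq hD hM h hc h₁ hc₁ h₂ (h1e.trans hP.2.symm)
      have d3 := dvd_two_mul_det_of_gcd_eq hD hM h hc h₁ hc₁ h₃ (h1e.trans hQ.2.symm)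
      simp only [Prod.mk.injEq] at hPQ
      obtain ⟨hW, hs⟩ := hPQ
      have hW' : X₁ * Y₂ - X₂ * Y₁ = X₁ * Y₃ - X₃ * Y₁ := by
        have := Int.ediv_left_inj d2 d3 |>.1 hW
        linarith
      have hid2 : (X₁ * X₂ + D * Y₁ * Y₂) ^ 2 + D * (X₁ * Y₂ - X₂ * Y₁) ^ 2 = M ^ 2 := by
        linear_combination (X₂ ^ 2 + D * Y₂ ^ 2) * h₁ + M * h₂
      have hid3 : (X₁ * X₃ + D * Y₁ * Y₃) ^ 2 + D * (X₁ * Y₃ - X₃ * Y₁) ^ 2 = M ^ 2 := by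
        linear_combination (X₃ ^ 2 + D * Y₃ ^ 2) * h₁ + M * h₃
      have hC : X₁ * X₂ + D * Y₁ * Y₂ = X₁ * X₃ + D * Y₁ * Y₃ := by
        have habs : |X₁ * X₂ + D * Y₁ * Y₂| = |X₁ * X₃ + D * Y₁ * Y₃| := by
          rw [← sq_eq_sq_iff_abs_eq_abs]
          rw [hW'] at hid2
          linarith
        rw [← sign_mul_abs (X₁ * X₂ + D * Y₁ * Y₂), ← sign_mul_abs (X₁ * X₃ + D * Y₁ * Y₃),
          habs, hs]
      -- The linear map (X₂, Y₂) ↦ (X₁X₂ + DY₁Y₂, X₁Y₂ - X₂Y₁) has determinant M ≠ 0, so it is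
      -- injective.
      have e1 : M * (X₂ - X₃) = 0 := by
        linear_combination (X₂ - X₃) * (-h₁) + X₁ * hC - D * Y₁ * hW'
      have e2 : M * (Y₂ - Y₃) = 0 := by
        linear_combination (Y₂ - Y₃) * (-h₁) + Y₁ * hC + X₁ * hW'
      have e1' := (mul_eq_zero.1 e1).resolve_left hM.ne'
      have e2' := (mul_eq_zero.1 e2).resolve_left hM.ne'
      rw [sub_eq_zero.1 e1', sub_eq_zero.1 e2']

/-- A solution with gcd g is g times a primitive solution for M / g². Both g and M / g² divide M, so
each of the two choices costs one divisor count. -/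
theorem card_repr_le_of_squarefree {D M : ℤ} (hD : Squarefree D) (hD0 : 0 < D) (hM : 0 < M)
    (S : Finset (ℤ × ℤ)) (hS : ∀ P ∈ S, P.1 ^ 2 + D * P.2 ^ 2 = M) :
    S.card ≤ 15 * M.natAbs.divisors.card ^ 2 := by
  classical
  rw [sq, ← mul_assoc]
  have hgM : ∀ P ∈ S, ((Int.gcd P.1 P.2 : ℕ) : ℤ) ^ 2 ∣ M := by
    intro P hP
    rw [← hS P hP]
    exact dvd_add (pow_dvd_pow_of_dvd (Int.gcd_dvd_left _ _) 2)
      ((pow_dvd_pow_of_dvd (Int.gcd_dvd_right _ _) 2).mul_left D)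
  refine Finset.card_le_mul_card_image_of_maps_to
    (f := fun P : ℤ × ℤ => Int.gcd P.1 P.2) ?_ _ ?_
  · intro P hP
    simp only [Nat.mem_divisors]
    refine ⟨?_, by simpa using hM.ne'⟩
    rw [← Int.natCast_dvd]
    exact (dvd_pow_self _ two_ne_zero).trans (hgM P hP)
  · intro g hg
    rcases (S.filter (fun P : ℤ × ℤ => Int.gcd P.1 P.2 = g)).eq_empty_or_nonempty
      with h1 | ⟨P₀, h1⟩
    · rw [h1]; simp
    rw [Finset.mem_filter] at h1
    have hgdvd := hgM P₀ h1.1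
    rw [h1.2] at hgdvd
    obtain ⟨M', hM'⟩ := hgdvd
    have hg0 : (g : ℤ) ≠ 0 := by
      rintro h0; rw [h0] at hM'; simp at hM'; omega
    have hgpos : 0 < (g : ℤ) ^ 2 := by positivity
    have hM'0 : 0 < M' := by
      rw [hM'] at hM; exact pos_of_mul_pos_right hM hgpos.le
    have hinj : Set.InjOn (fun P : ℤ × ℤ => (P.1 / g, P.2 / g))
        (S.filter (fun P : ℤ × ℤ => Int.gcd P.1 P.2 = g)) := by
      rintro ⟨a, b⟩ hP ⟨c, d⟩ hQ hPQ
      simp only [Finset.coe_filter, Set.mem_ofPred_eq] at hP hQ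
      simp only [Prod.mk.injEq] at hPQ
      have ha : (g : ℤ) ∣ a := by rw [← hP.2]; exact Int.gcd_dvd_left _ _
      have hb : (g : ℤ) ∣ b := by rw [← hP.2]; exact Int.gcd_dvd_right _ _
      have hc : (g : ℤ) ∣ c := by rw [← hQ.2]; exact Int.gcd_dvd_left _ _
      have hd : (g : ℤ) ∣ d := by rw [← hQ.2]; exact Int.gcd_dvd_right _ _
      rw [Int.ediv_left_inj ha hc |>.1 hPQ.1, Int.ediv_left_inj hb hd |>.1 hPQ.2]
    rw [← Finset.card_image_of_injOn hinj]
    refine (card_primitive_repr_le hD hD0 hM'0 _ ?_).trans ?_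
    · intro Q hQ
      rw [Finset.mem_image] at hQ
      obtain ⟨⟨a, b⟩, hP, rfl⟩ := hQ
      rw [Finset.mem_filter] at hP
      obtain ⟨hPS, hPg⟩ := hP
      simp only at hPg ⊢
      have ha : (g : ℤ) ∣ a := by rw [← hPg]; exact Int.gcd_dvd_left _ _
      have hb : (g : ℤ) ∣ b := by rw [← hPg]; exact Int.gcd_dvd_right _ _
      refine ⟨?_, ?_⟩
      · have := hS _ hPS
        simp only at this
        obtain ⟨a', rfl⟩ := ha
        obtain ⟨b', rfl⟩ := hb
        rw [Int.mul_ediv_cancel_left _ hg0, Int.mul_ediv_cancel_left _ hg0]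
        rw [hM'] at this
        refine mul_left_cancel₀ hgpos.ne' ?_
        linear_combination this
      · rw [Int.isCoprime_iff_gcd_eq_one, ← hPg]
        refine Int.gcd_ediv_gcd_ediv_gcd ?_
        rw [hPg]; exact Nat.pos_of_ne_zero (by exact_mod_cast hg0)
    · refine Nat.mul_le_mul_left _ (Finset.card_le_card (Nat.divisors_subset_of_dvd ?_ ?_))
      · simpa using hM.ne'
      · rw [hM', Int.natAbs_mul]; exact dvd_mul_left _ _

/-- Writing D = b² a with a squarefree, the factor b is absorbed into Y. -/
theorem card_repr_le {D M : ℤ} (hD0 : 0 < D) (hM : 0 < M)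
    (S : Finset (ℤ × ℤ)) (hS : ∀ P ∈ S, P.1 ^ 2 + D * P.2 ^ 2 = M) :
    S.card ≤ 15 * M.natAbs.divisors.card ^ 2 := by
  classical
  obtain ⟨a, b, hab, ha⟩ := Nat.sq_mul_squarefree D.natAbs
  have hD : D = (b : ℤ) ^ 2 * a := by
    have : (D.natAbs : ℤ) = D := Int.natAbs_of_nonneg hD0.le
    rw [← this, ← hab]; push_cast; ring
  have hb : (b : ℤ) ≠ 0 := by rintro h; rw [h] at hD; simp at hD; omega
  have ha0 : 0 < (a : ℤ) := by
    rcases Nat.eq_zero_or_pos a with h | h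
    · subst h; simp at hD; omega
    · exact_mod_cast h
  have hinj : Function.Injective (fun P : ℤ × ℤ => (P.1, b * P.2)) := by
    rintro ⟨x, y⟩ ⟨z, w⟩ h
    simp only [Prod.mk.injEq] at h
    rw [h.1, mul_left_cancel₀ hb h.2]
  rw [← Finset.card_image_of_injective S hinj]
  refine card_repr_le_of_squarefree (D := a) ?_ ha0 hM _ ?_
  · rwa [Int.squarefree_natCast]
  · intro Q hQ
    rw [Finset.mem_image] at hQ
    obtain ⟨P, hP, rfl⟩ := hQ
    rw [← hS P hP, hD]; ring

/-! ### From points near a circle to integer points on a conic -/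

/-- Simultaneous Diophantine approximation, obtained by iterating Dirichlet's theorem. -/
theorem exists_simultaneous_approx {H : ℕ} (hH : 0 < H) (n : ℕ) (θ : Fin n → ℝ) :
    ∃ q : ℕ, 0 < q ∧ q ≤ H ^ (2 ^ n - 1) ∧ ∀ i, ∃ p : ℤ, |(q : ℝ) * θ i - p| ≤ 1 / H := by
  induction n with
  | zero => exact ⟨1, one_pos, by simp, fun i => i.elim0⟩
  | succ n ih =>
    obtain ⟨k, hk0, hk, hke⟩ :=
      Real.exists_nat_abs_mul_sub_round_le (θ (Fin.last n)) (n := H ^ 2 ^ n) (by positivity)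
    obtain ⟨q, hq0, hq, hqe⟩ := ih (fun i => k * θ i.castSucc)
    have hHR : (0 : ℝ) < H := by exact_mod_cast hH
    have h2 : 2 ^ n = (2 ^ n - 1) + 1 := (Nat.sub_add_cancel Nat.one_le_two_pow).symm
    -- The last number is approximated first, to accuracy H^{-2^n} by the multiplier k. The later
    -- multiplier q ≤ H^{2^n - 1} for the numbers k θᵢ then degrades that accuracy only to 1/H.
    refine ⟨q * k, by positivity, ?_, fun i => ?_⟩
    · calc q * k ≤ H ^ (2 ^ n - 1) * H ^ 2 ^ n := Nat.mul_le_mul hq hk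
        _ = H ^ (2 ^ (n + 1) - 1) := by rw [← pow_add]; congr 1; rw [pow_succ]; omega
    · refine Fin.lastCases ?_ (fun j => ?_) i
      · refine ⟨q * round (k * θ (Fin.last n)), ?_⟩
        push_cast
        rw [mul_assoc, ← mul_sub, abs_mul, Nat.abs_cast]
        have h3 : (q : ℝ) ≤ (H : ℝ) ^ (2 ^ n - 1) := by exact_mod_cast hq
        have h4 : |(k : ℝ) * θ (Fin.last n) - round (k * θ (Fin.last n))|
            ≤ 1 / (H : ℝ) ^ 2 ^ n := by
          refine hke.trans ?_
          push_cast
          gcongr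
          linarith
        calc _ ≤ (H : ℝ) ^ (2 ^ n - 1) * (1 / (H : ℝ) ^ 2 ^ n) :=
              mul_le_mul h3 h4 (abs_nonneg _) (by positivity)
          _ = 1 / H := by
            conv_lhs => rw [h2]
            rw [Nat.add_sub_cancel, pow_succ]
            field_simp
      · obtain ⟨p, hp⟩ := hqe j
        refine ⟨p, ?_⟩
        push_cast
        rwa [mul_assoc]

/-- Integer points on the conic `q m² + p₁ n² + p₂ m + p₃ n + p₄ = 0` with `q, p₁ > 0`. -/
theorem exists_card_conic_le {ε : ℝ} (hε : 0 < ε) :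
    ∃ C : ℝ, 1 ≤ C ∧ ∀ (B : ℝ) (q p₁ p₂ p₃ p₄ : ℤ), 1 ≤ B → 0 < q → 0 < p₁ → (q : ℝ) ≤ B →
      (p₁ : ℝ) ≤ B → |(p₂ : ℝ)| ≤ B → |(p₃ : ℝ)| ≤ B → |(p₄ : ℝ)| ≤ B → ∀ S : Finset (ℤ × ℤ),
      (∀ P ∈ S, q * P.1 ^ 2 + p₁ * P.2 ^ 2 + p₂ * P.1 + p₃ * P.2 + p₄ = 0) →
      (S.card : ℝ) ≤ C * B ^ ε := by
  classical
  -- The divisor count enters squared and M ≤ 6 B⁴, so the exponent ε is divided by 8.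
  obtain ⟨C, hC1, hC⟩ := exists_card_divisors_le_rpow (ε := ε / 8) (by positivity)
  refine ⟨15 * (C * 6 ^ (ε / 8)) ^ 2, ?_, ?_⟩
  · have : (1 : ℝ) ≤ 6 ^ (ε / 8) := Real.one_le_rpow (by norm_num) (by positivity)
    have h2 : 1 ≤ C * 6 ^ (ε / 8) := one_le_mul_of_one_le_of_one_le hC1 this
    have : 1 ≤ (C * 6 ^ (ε / 8)) ^ 2 := one_le_pow₀ h2
    linarith
  intro B q p₁ p₂ p₃ p₄ hB hq hp₁ hqB h1B h2B h3B h4B S hS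
  -- Multiplying the equation by 4 q p₁² completes both squares: X = p₁ (2 q m + p₂), Y = 2 p₁ n +
  -- p₃, D = q p₁.
  set M : ℤ := -4 * q * p₁ ^ 2 * p₄ + p₁ ^ 2 * p₂ ^ 2 + q * p₁ * p₃ ^ 2 with hM
  set f : ℤ × ℤ → ℤ × ℤ := fun P => (p₁ * (2 * q * P.1 + p₂), 2 * p₁ * P.2 + p₃) with hf
  have hinj : Function.Injective f := by
    rintro ⟨a, b⟩ ⟨c, d⟩ h
    simp only [hf, Prod.mk.injEq, mul_eq_mul_left_iff, add_left_inj, hp₁.ne', hq.ne', or_false,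
      mul_eq_zero, OfNat.ofNat_ne_zero] at h
    rw [h.1, h.2]
  have himg : ∀ Q ∈ S.image f, Q.1 ^ 2 + q * p₁ * Q.2 ^ 2 = M := by
    intro Q hQ
    rw [Finset.mem_image] at hQ
    obtain ⟨P, hP, rfl⟩ := hQ
    have := hS P hP
    simp only [hf, hM]
    linear_combination 4 * q * p₁ ^ 2 * this
  rw [← Finset.card_image_of_injective S hinj]
  have hBpow : (1 : ℝ) ≤ B ^ ε := Real.one_le_rpow hB hε.le
  have hD : 0 < q * p₁ := mul_pos hq hp₁
  rcases (S.image f).eq_empty_or_nonempty with h0 | ⟨Q₀, hQ₀⟩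
  · rw [h0]; simp; positivity
  have hM0 : 0 ≤ M := by rw [← himg Q₀ hQ₀]; positivity
  -- For M = 0 the form is definite and only X = Y = 0 remains.
  rcases hM0.eq_or_lt with hM0 | hMpos
  · have : (S.image f).card ≤ 1 := by
      rw [Finset.card_le_one]
      have hz : ∀ Q ∈ S.image f, Q = (0, 0) := by
        intro Q hQ
        have h := himg Q hQ
        rw [← hM0] at h
        have h1 : 0 ≤ q * p₁ * Q.2 ^ 2 := by positivity
        have h2 : Q.1 ^ 2 = 0 := by nlinarith [sq_nonneg Q.1]
        have h3 : q * p₁ * Q.2 ^ 2 = 0 := by nlinarith [sq_nonneg Q.1]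
        rcases mul_eq_zero.1 h3 with h4 | h4
        · omega
        · exact Prod.ext (pow_eq_zero_iff two_ne_zero |>.1 h2) (pow_eq_zero_iff two_ne_zero |>.1 h4)
      intro a ha b hb
      rw [hz a ha, hz b hb]
    have h15 : (1 : ℝ) ≤ 15 * (C * 6 ^ (ε / 8)) ^ 2 := by
      have : (1 : ℝ) ≤ 6 ^ (ε / 8) := Real.one_le_rpow (by norm_num) (by positivity)
      have h2 : 1 ≤ C * 6 ^ (ε / 8) := one_le_mul_of_one_le_of_one_le hC1 this
      have : 1 ≤ (C * 6 ^ (ε / 8)) ^ 2 := one_le_pow₀ h2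
      linarith
    calc ((S.image f).card : ℝ) ≤ 1 := by exact_mod_cast this
      _ ≤ _ := one_le_mul_of_one_le_of_one_le h15 hBpow
  · have hcard := card_repr_le hD hMpos _ himg
    have hMB : (M : ℝ) ≤ 6 * B ^ 4 := by
      have hq' : (0 : ℝ) ≤ q := by exact_mod_cast hq.le
      have hp' : (0 : ℝ) ≤ p₁ := by exact_mod_cast hp₁.le
      have e2 : (p₂ : ℝ) ^ 2 ≤ B ^ 2 := sq_le_sq' (abs_le.1 h2B).1 (abs_le.1 h2B).2
      have e3 : (p₃ : ℝ) ^ 2 ≤ B ^ 2 := sq_le_sq' (abs_le.1 h3B).1 (abs_le.1 h3B).2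
      have e4 : -(p₄ : ℝ) ≤ B := by linarith [(abs_le.1 h4B).1]
      have e5 : (p₁ : ℝ) ^ 2 ≤ B ^ 2 := by gcongr
      have t1 : (q : ℝ) * p₁ ^ 2 * (-p₄) ≤ B * B ^ 2 * B := by
        have : (q : ℝ) * p₁ ^ 2 ≤ B * B ^ 2 := by gcongr
        calc (q : ℝ) * p₁ ^ 2 * (-p₄) ≤ (q : ℝ) * p₁ ^ 2 * B := by gcongr
          _ ≤ _ := by gcongr
      have t2 : (p₁ : ℝ) ^ 2 * p₂ ^ 2 ≤ B ^ 2 * B ^ 2 := by gcongr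
      have t3 : (q : ℝ) * p₁ * p₃ ^ 2 ≤ B * B * B ^ 2 := by gcongr
      rw [hM]; push_cast
      nlinarith
    have hnat : ((M.natAbs : ℕ) : ℝ) = M := by
      rw [Nat.cast_natAbs, abs_of_pos hMpos]
    have hd := hC M.natAbs (by simpa using hMpos.ne')
    rw [hnat] at hd
    have hd2 : (M.natAbs.divisors.card : ℝ) ≤ C * 6 ^ (ε / 8) * B ^ (ε / 2) := by
      refine hd.trans ?_
      rw [mul_assoc]
      refine mul_le_mul_of_nonneg_left ?_ (by linarith)
      calc (M : ℝ) ^ (ε / 8) ≤ (6 * B ^ 4) ^ (ε / 8) :=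
            Real.rpow_le_rpow (by exact_mod_cast hM0) hMB (by positivity)
        _ = 6 ^ (ε / 8) * B ^ (ε / 2) := by
            rw [Real.mul_rpow (by norm_num) (by positivity), ← Real.rpow_natCast,
              ← Real.rpow_mul (by linarith)]
            congr 2; push_cast; ring
    calc ((S.image f).card : ℝ) ≤ 15 * (M.natAbs.divisors.card : ℝ) ^ 2 := by exact_mod_cast hcard
      _ ≤ 15 * (C * 6 ^ (ε / 8) * B ^ (ε / 2)) ^ 2 := by gcongr
      _ = 15 * (C * 6 ^ (ε / 8)) ^ 2 * B ^ ε := by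
          rw [mul_pow (C * 6 ^ (ε / 8)), ← Real.rpow_natCast (B ^ (ε / 2)),
            ← Real.rpow_mul (by linarith)]
          push_cast
          rw [div_mul_cancel₀ _ two_ne_zero]
          ring

theorem card_int_le_of_forall_abs_le {x : ℝ} (S : Finset ℤ) (hS : ∀ m ∈ S, |(m : ℝ)| ≤ x)
    (hx : 0 ≤ x) : (S.card : ℝ) ≤ 2 * x + 1 := by
  have hsub : S ⊆ Finset.Icc (-⌊x⌋) ⌊x⌋ := by
    intro m hm
    have := abs_le.1 (hS m hm)
    rw [Finset.mem_Icc]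
    refine ⟨?_, Int.le_floor.2 this.2⟩
    have : -m ≤ ⌊x⌋ := Int.le_floor.2 (by push_cast; linarith)
    omega
  have h := Finset.card_le_card hsub
  rw [Int.card_Icc] at h
  have hfl : 0 ≤ ⌊x⌋ := Int.floor_nonneg.2 hx
  have : (S.card : ℤ) ≤ 2 * ⌊x⌋ + 1 := by omega
  have h2 : (S.card : ℝ) ≤ 2 * (⌊x⌋ : ℝ) + 1 := by exact_mod_cast this
  linarith [Int.floor_le x]

set_option maxHeartbeats 1000000 in
/-- Lattice points of `N⁻¹ℤ × N⁻²ℤ` that lie extremely close to a circle. -/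
theorem exists_card_near_circle_le {ε A : ℝ} (hε : 0 < ε) (hA : 0 ≤ A) :
    ∃ C : ℝ, 1 ≤ C ∧ ∀ N R a b τ : ℝ, 1 ≤ N → N ^ 200 ≤ R → a ∈ Set.Icc (0 : ℝ) 1 →
      b ∈ Set.Icc (0 : ℝ) 1 → ∀ S : Finset (ℤ × ℤ),
      (∀ P ∈ S, |a + P.1 / N| ≤ 2 ∧ |b + P.2 / N ^ 2| ≤ 2 ∧
        |(a + P.1 / N) ^ 2 + (b + P.2 / N ^ 2) ^ 2 - τ| ≤ A / R) →
      (S.card : ℝ) ≤ C * R ^ ε := by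
  classical
  obtain ⟨C, hC1, hC⟩ := exists_card_conic_le (ε := ε) hε
  set T : ℝ := 65 ^ 15 with hT
  have hT1 : 1 ≤ T := by norm_num [hT]
  have hTpos : 0 < T := by linarith
  clear_value T
  -- Beyond R₀ one has √R ≥ 4 A T, which absorbs the constants in `hfirst`. Below it N ≤ R₀, and the
  -- trivial count 49 N³ is a constant.
  set R₀ : ℝ := (4 * A * T) ^ 2 + 1 with hR₀
  have hR₀1 : 1 ≤ R₀ := by rw [hR₀]; nlinarith [sq_nonneg (4 * A * T)]
  refine ⟨49 * R₀ ^ 3 + C * (T * (11 + A)) ^ ε, ?_, ?_⟩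
  · have : 1 ≤ R₀ ^ 3 := one_le_pow₀ hR₀1
    have : 0 ≤ C * (T * (11 + A)) ^ ε := by positivity
    linarith
  intro N R a b τ hN hNR ha hb S hS
  have hNpos : 0 < N := by linarith
  have hR1 : 1 ≤ R := (one_le_pow₀ hN).trans hNR
  have hRpos : 0 < R := by linarith
  have hRε : 1 ≤ R ^ ε := Real.one_le_rpow hR1 hε.le
  have hbound : ∀ P ∈ S, |(P.1 : ℝ)| ≤ 3 * N ∧ |(P.2 : ℝ)| ≤ 3 * N ^ 2 := by
    intro P hP
    obtain ⟨h1, h2, -⟩ := hS P hP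
    constructor
    · have : |(P.1 : ℝ) / N| ≤ 3 := by
        rw [abs_le] at h1 ⊢; constructor <;> linarith [h1.1, h1.2, ha.1, ha.2]
      rwa [abs_div, abs_of_pos hNpos, div_le_iff₀ hNpos] at this
    · have hN2 : 0 < N ^ 2 := by positivity
      have : |(P.2 : ℝ) / N ^ 2| ≤ 3 := by
        rw [abs_le] at h2 ⊢; constructor <;> linarith [h2.1, h2.2, hb.1, hb.2]
      rwa [abs_div, abs_of_pos hN2, div_le_iff₀ hN2] at this
  have hN12 : N ≤ N ^ 2 := le_self_pow₀ hN two_ne_zero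
  have hN24 : N ^ 2 ≤ N ^ 4 := pow_le_pow_right₀ hN (by norm_num)
  have hN2one : 1 ≤ N ^ 2 := one_le_pow₀ hN
  rcases lt_or_ge R R₀ with hRR | hRR
  · have hNR' : N ≤ R₀ := (le_self_pow₀ hN (by norm_num)).trans (hNR.trans hRR.le)
    have hsub : S ⊆ (S.image Prod.fst) ×ˢ (S.image Prod.snd) := fun P hP =>
      Finset.mem_product.2 ⟨Finset.mem_image_of_mem _ hP, Finset.mem_image_of_mem _ hP⟩
    have h1 := card_int_le_of_forall_abs_le (x := 3 * N) (S.image Prod.fst) (by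
      intro m hm
      obtain ⟨P, hP, rfl⟩ := Finset.mem_image.1 hm
      exact (hbound P hP).1) (by positivity)
    have h2 := card_int_le_of_forall_abs_le (x := 3 * N ^ 2) (S.image Prod.snd) (by
      intro m hm
      obtain ⟨P, hP, rfl⟩ := Finset.mem_image.1 hm
      exact (hbound P hP).2) (by positivity)
    have h3 : (S.card : ℝ) ≤ (S.image Prod.fst).card * (S.image Prod.snd).card := by
      exact_mod_cast (Finset.card_le_card hsub).trans (Finset.card_product _ _).le
    calc (S.card : ℝ) ≤ (7 * N) * (7 * N ^ 2) := h3.trans (by gcongr <;> linarith)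
      _ = 49 * N ^ 3 := by ring
      _ ≤ 49 * R₀ ^ 3 := by gcongr
      _ ≤ 49 * R₀ ^ 3 + C * (T * (11 + A)) ^ ε := by
          have : 0 ≤ C * (T * (11 + A)) ^ ε := by positivity
          linarith
      _ ≤ _ := le_mul_of_one_le_right (by positivity) hRε
  rcases S.eq_empty_or_nonempty with rfl | ⟨P₀, hP₀⟩
  · simp; positivity
  have hτ : |τ| ≤ 8 + A := by
    obtain ⟨h1, h2, h3⟩ := hS P₀ hP₀
    have h4 : A / R ≤ A := div_le_self hA hR1
    have h5 := sq_le_sq' (abs_le.1 h1).1 (abs_le.1 h1).2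
    have h6 := sq_le_sq' (abs_le.1 h2).1 (abs_le.1 h2).2
    have h7 := abs_le.1 h3
    rw [abs_le]
    constructor <;> nlinarith [h7.1, h7.2, sq_nonneg (a + P₀.1 / N), sq_nonneg (b + P₀.2 / N ^ 2)]
  -- As |m| ≤ 3N and |n| ≤ 3N², approximation errors 1/H are magnified by at most 16 N⁴; this H
  -- keeps the total below 1/4.
  obtain ⟨H, hH⟩ : ∃ H : ℕ, H = ⌈64 * N ^ 4⌉₊ := ⟨_, rfl⟩
  have hN4 : 1 ≤ N ^ 4 := one_le_pow₀ hN
  have hHge : 64 * N ^ 4 ≤ H := by rw [hH]; exact Nat.le_ceil _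
  have hHle : (H : ℝ) ≤ 65 * N ^ 4 := by
    have := (Nat.ceil_lt_add_one (a := 64 * N ^ 4) (by positivity)).le
    rw [← hH] at this
    linarith
  have hHpos : 0 < H := by
    have : (0 : ℝ) < H := by linarith
    exact_mod_cast this
  -- After multiplication by N² the circle equation reads m² + n²/N² + 2aN m + 2b n + κ ≈ 0. Its
  -- four real coefficients are approximated with one denominator q ≤ H^15 ≤ T N^60.
  set κ : ℝ := N ^ 2 * (a ^ 2 + b ^ 2 - τ) with hκ
  obtain ⟨q, hq0, hqH, hqe⟩ :=
    exists_simultaneous_approx hHpos 4 ![1 / N ^ 2, 2 * a * N, 2 * b, κ]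
  obtain ⟨p₁, hp₁⟩ := hqe 0
  obtain ⟨p₂, hp₂⟩ := hqe 1
  obtain ⟨p₃, hp₃⟩ := hqe 2
  obtain ⟨p₄, hp₄⟩ := hqe 3
  simp only [Matrix.cons_val] at hp₁ hp₂ hp₃ hp₄
  have hHinv : (1 : ℝ) / H ≤ 1 / (64 * N ^ 4) := by gcongr
  have hHinv1 : (1 : ℝ) / H ≤ 1 := by
    rw [div_le_one (by exact_mod_cast hHpos)]; linarith
  have hq1 : (1 : ℝ) ≤ q := by exact_mod_cast hq0
  have hqT : (q : ℝ) ≤ T * N ^ 60 := by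
    have h1 : (q : ℝ) ≤ (H : ℝ) ^ 15 := by
      have := hqH
      norm_num at this
      exact_mod_cast this
    calc (q : ℝ) ≤ (65 * N ^ 4) ^ 15 := h1.trans (by gcongr)
      _ = T * N ^ 60 := by rw [hT]; ring
  -- The error 1/H is smaller than 1/N², so the approximating conic is still an ellipse.
  have hp₁pos : 0 < p₁ := by
    have h1 := (abs_le.1 hp₁).2
    have h2 : 1 / (64 * N ^ 4) < 1 / N ^ 2 := by
      apply one_div_lt_one_div_of_lt <;> nlinarith
    have h3 : 1 / N ^ 2 ≤ q * (1 / N ^ 2) := le_mul_of_one_le_left (by positivity) hq1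
    have : (0 : ℝ) < p₁ := by linarith
    exact_mod_cast this
  -- The left side is an integer. It differs from q N² times the defect, itself at most 1/4 since
  -- N^62 ≤ √R, by at most 1/4; hence it vanishes.
  have hexact : ∀ P ∈ S, (q : ℤ) * P.1 ^ 2 + p₁ * P.2 ^ 2 + p₂ * P.1 + p₃ * P.2 + p₄ = 0 := by
    rintro ⟨m, n⟩ hP
    obtain ⟨hm, hn⟩ := hbound _ hP
    obtain ⟨-, -, h3⟩ := hS _ hP
    simp only at hm hn h3 ⊢
    have hid : (((q : ℤ) * m ^ 2 + p₁ * n ^ 2 + p₂ * m + p₃ * n + p₄ : ℤ) : ℝ)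
        = q * (N ^ 2 * ((a + m / N) ^ 2 + (b + n / N ^ 2) ^ 2 - τ))
          - ((q * (1 / N ^ 2) - p₁) * n ^ 2 + (q * (2 * a * N) - p₂) * m
            + (q * (2 * b) - p₃) * n + (q * κ - p₄)) := by
      push_cast
      rw [hκ]
      field_simp
      ring
    have hfirst : |(q : ℝ) * (N ^ 2 * ((a + m / N) ^ 2 + (b + n / N ^ 2) ^ 2 - τ))| ≤ 1 / 4 := by
      rw [abs_mul, abs_mul, Nat.abs_cast, abs_of_pos (by positivity : 0 < N ^ 2)]
      calc _ ≤ T * N ^ 60 * (N ^ 2 * (A / R)) := by gcongr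
        _ = T * A * N ^ 62 / R := by ring
        _ ≤ 1 / 4 := by
          rw [div_le_iff₀ hRpos]
          have hs : R = Real.sqrt R * Real.sqrt R := (Real.mul_self_sqrt hRpos.le).symm
          have h5 : 4 * A * T ≤ Real.sqrt R := by
            apply Real.le_sqrt_of_sq_le; linarith
          have h6 : N ^ 62 ≤ Real.sqrt R := by
            apply Real.le_sqrt_of_sq_le
            calc (N ^ 62) ^ 2 = N ^ 124 := by ring
              _ ≤ N ^ 200 := pow_le_pow_right₀ hN (by norm_num)
              _ ≤ R := hNR
          have h7 : (4 * A * T) * N ^ 62 ≤ Real.sqrt R * Real.sqrt R := by gcongr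
          linarith
    have hsecond : |(q * (1 / N ^ 2) - p₁) * (n : ℝ) ^ 2 + (q * (2 * a * N) - p₂) * m
            + (q * (2 * b) - p₃) * n + (q * κ - p₄)| ≤ 1 / 4 := by
      have hn2 : |(n : ℝ) ^ 2| ≤ 9 * N ^ 4 := by
        rw [abs_pow]
        calc |(n : ℝ)| ^ 2 ≤ (3 * N ^ 2) ^ 2 := by gcongr
          _ = 9 * N ^ 4 := by ring
      have s1 : |(q * (1 / N ^ 2) - p₁) * (n : ℝ) ^ 2| ≤ 1 / H * (9 * N ^ 4) := by
        rw [abs_mul]; gcongr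
      have s2 : |(q * (2 * a * N) - p₂) * (m : ℝ)| ≤ 1 / H * (3 * N) := by
        rw [abs_mul]; gcongr
      have s3 : |(q * (2 * b) - p₃) * (n : ℝ)| ≤ 1 / H * (3 * N ^ 2) := by
        rw [abs_mul]; gcongr
      calc _ ≤ 1 / H * (9 * N ^ 4) + 1 / H * (3 * N) + 1 / H * (3 * N ^ 2) + 1 / (H : ℝ) := by
            refine (abs_add_le _ _).trans (add_le_add ((abs_add_le _ _).trans (add_le_add
              ((abs_add_le _ _).trans (add_le_add s1 s2)) s3)) hp₄)
        _ = 1 / H * (9 * N ^ 4 + 3 * N + 3 * N ^ 2 + 1) := by ring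
        _ ≤ 1 / (64 * N ^ 4) * (16 * N ^ 4) := by gcongr; linarith
        _ = 1 / 4 := by field_simp; norm_num
    have hlt : |(((q : ℤ) * m ^ 2 + p₁ * n ^ 2 + p₂ * m + p₃ * n + p₄ : ℤ) : ℝ)| < 1 := by
      rw [hid]
      exact (abs_sub _ _).trans_lt (by linarith)
    exact Int.abs_lt_one_iff.1 (by exact_mod_cast hlt)
  set B : ℝ := T * (11 + A) * N ^ 62 with hB
  have hN62 : N ^ 60 * N ^ 2 = N ^ 62 := by ring
  have hqB' : (q : ℝ) * ((11 + A) * N ^ 2) ≤ B := by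
    calc _ ≤ T * N ^ 60 * ((11 + A) * N ^ 2) := by gcongr
      _ = B := by rw [hB]; ring
  have hcoef : ∀ (t : ℝ) (p : ℤ), |t| ≤ (10 + A) * N ^ 2 → |(q : ℝ) * t - p| ≤ 1 / H →
      |(p : ℝ)| ≤ B := by
    intro t p ht hp
    have h1 : |(p : ℝ)| ≤ |(q : ℝ) * t| + 1 := by
      have := abs_sub ((q : ℝ) * t) ((q : ℝ) * t - p)
      rw [sub_sub_cancel] at this
      linarith
    rw [abs_mul, Nat.abs_cast] at h1
    have h2 : (q : ℝ) * |t| ≤ q * ((10 + A) * N ^ 2) := by gcongr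
    have h3 : (1 : ℝ) ≤ q * N ^ 2 := one_le_mul_of_one_le_of_one_le hq1 hN2one
    calc |(p : ℝ)| ≤ q * ((10 + A) * N ^ 2) + q * N ^ 2 := by linarith
      _ = (q : ℝ) * ((11 + A) * N ^ 2) := by ring
      _ ≤ B := hqB'
  have hAN : 0 ≤ A * N ^ 2 := by positivity
  have hB1 : 1 ≤ B := by
    refine le_trans ?_ hqB'
    refine one_le_mul_of_one_le_of_one_le hq1 (one_le_mul_of_one_le_of_one_le (by linarith) hN2one)
  have hp1B := hcoef _ p₁ (by
    rw [abs_of_pos (by positivity)]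
    have : 1 / N ^ 2 ≤ 1 := by rw [div_le_one (by positivity)]; exact hN2one
    nlinarith) hp₁
  have hp2B := hcoef _ p₂ (by
    have := ha.1
    rw [abs_of_nonneg (by positivity)]
    nlinarith [ha.2]) hp₂
  have hp3B := hcoef _ p₃ (by
    have := hb.1
    rw [abs_of_nonneg (by positivity)]
    nlinarith [hb.2]) hp₃
  have hp4B := hcoef _ p₄ (by
    rw [hκ, abs_mul, abs_of_pos (by positivity : 0 < N ^ 2), mul_comm]
    gcongr
    obtain ⟨h1, h2⟩ := abs_le.1 hτ
    have ha2 : a ^ 2 ≤ 1 := pow_le_one₀ ha.1 ha.2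
    have hb2 : b ^ 2 ≤ 1 := pow_le_one₀ hb.1 hb.2
    rw [abs_le]
    constructor <;> nlinarith [sq_nonneg a, sq_nonneg b]) hp₄
  have hfin := hC B q p₁ p₂ p₃ p₄ hB1 (by exact_mod_cast hq0) hp₁pos (by
    refine le_trans ?_ hqB'
    push_cast
    exact le_mul_of_one_le_right (by positivity)
      (one_le_mul_of_one_le_of_one_le (by linarith) hN2one)) ((le_abs_self _).trans hp1B)
    hp2B hp3B hp4B S hexact
  calc (S.card : ℝ) ≤ C * B ^ ε := hfin
    _ ≤ C * ((T * (11 + A)) ^ ε * R ^ ε) := by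
        rw [← Real.mul_rpow (by positivity) hRpos.le]
        gcongr
        rw [hB]
        gcongr
        exact (pow_le_pow_right₀ hN (by norm_num)).trans hNR
    _ = C * (T * (11 + A)) ^ ε * R ^ ε := by ring
    _ ≤ _ := by
        gcongr
        have : 0 ≤ 49 * R₀ ^ 3 := by positivity
        linarith

/-! ### Surface measure of caps and small cubes -/

open scoped Pointwise in
theorem sphereMeasure_apply {d : ℕ} {A : Set (EuclideanSpace ℝ (Fin d))} (hA : MeasurableSet A) :
    sphereMeasure d A = d * (volume : Measure (EuclideanSpace ℝ (Fin d)))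
      (Set.Ioo (0 : ℝ) 1 • (A ∩ Metric.sphere 0 1)) := by
  rw [sphereMeasure, Measure.map_apply measurable_subtype_coe hA,
    Measure.toSphere_apply' _ (measurable_subtype_coe hA), Subtype.image_preimage_coe,
    finrank_euclideanSpace_fin, Set.inter_comm]

instance isFiniteMeasure_sphereMeasure (d : ℕ) : IsFiniteMeasure (sphereMeasure d) := by
  unfold sphereMeasure; infer_instance

theorem ae_sphereMeasure_norm_eq_one (d : ℕ) : ∀ᵐ ξ ∂(sphereMeasure d), ‖ξ‖ = 1 := by
  have hm : MeasurableSet {ξ : EuclideanSpace ℝ (Fin d) | ‖ξ‖ = 1} :=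
    (isClosed_eq continuous_norm continuous_const).measurableSet
  rw [sphereMeasure, ae_map_iff measurable_subtype_coe.aemeasurable hm]
  exact Filter.Eventually.of_forall fun x => by simp

open scoped Pointwise in
/-- A spherical cap of radius `ρ` has surface measure `O(ρ ^ (d - 1))`. -/
theorem exists_sphereMeasure_closedBall_le (d : ℕ) (hd : 1 ≤ d) :
    ∃ C : ℝ, 0 < C ∧ ∀ (x : EuclideanSpace ℝ (Fin d)) (ρ : ℝ), 0 < ρ →
      sphereMeasure d (Metric.closedBall x ρ) ≤ ENNReal.ofReal (C * ρ ^ (d - 1)) := by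
  set V : ℝ := (volume : Measure (EuclideanSpace ℝ (Fin d))).real (Metric.closedBall 0 1) with hV
  have hV0 : 0 ≤ V := measureReal_nonneg
  set s : ℝ := (sphereMeasure d).real Set.univ with hs
  have hs0 : 0 ≤ s := measureReal_nonneg
  refine ⟨d * (2 * 3 ^ d * V) + s + 1, by positivity, fun x ρ hρ => ?_⟩
  rcases lt_or_ge 1 ρ with h1 | h1
  · calc sphereMeasure d (Metric.closedBall x ρ) ≤ sphereMeasure d Set.univ :=
          measure_mono (Set.subset_univ _)
      _ = ENNReal.ofReal s := by rw [hs, ofReal_measureReal]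
      _ ≤ _ := by
          apply ENNReal.ofReal_le_ofReal
          have h2 : 1 ≤ ρ ^ (d - 1) := one_le_pow₀ h1.le
          have h3 : 0 ≤ d * (2 * 3 ^ d * V) := by positivity
          calc s ≤ d * (2 * 3 ^ d * V) + s + 1 := by linarith
            _ ≤ _ := le_mul_of_one_le_right (by positivity) h2
  -- The cone over the cap is a tube of length 1 and width about ρ: the balls of radius 3ρ around
  -- the points jρ x, at most 2/ρ of them, cover it. Its volume is thus O(ρ^{d-1}).
  have hcover : Set.Ioo (0 : ℝ) 1 • (Metric.closedBall x ρ ∩ Metric.sphere 0 1) ⊆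
      ⋃ j ∈ Finset.range (⌊1 / ρ⌋₊ + 1), Metric.closedBall ((j * ρ) • x) (3 * ρ) := by
    rintro _ ⟨t, ht, a, ⟨hax, ha⟩, rfl⟩
    have hj0 : 0 ≤ t / ρ := div_nonneg ht.1.le hρ.le
    have hj1 : (⌊t / ρ⌋₊ : ℝ) ≤ t / ρ := Nat.floor_le hj0
    have hj2 : t / ρ < ⌊t / ρ⌋₊ + 1 := Nat.lt_floor_add_one _
    rw [le_div_iff₀ hρ] at hj1
    rw [div_lt_iff₀ hρ] at hj2
    simp only [Set.mem_iUnion, Finset.mem_range]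
    refine ⟨⌊t / ρ⌋₊, ?_, ?_⟩
    · refine Nat.lt_succ_of_le (Nat.floor_le_floor ?_)
      gcongr
      exact ht.2.le
    · simp only [mem_sphere_iff_norm, sub_zero] at ha
      rw [mem_closedBall_iff_norm] at hax ⊢
      have hx : ‖x‖ ≤ 2 := by
        have := norm_sub_norm_le x a
        rw [norm_sub_rev] at this
        linarith
      have : t • a - ((⌊t / ρ⌋₊ : ℝ) * ρ) • x = t • (a - x) + (t - ⌊t / ρ⌋₊ * ρ) • x := by
        rw [smul_sub, sub_smul]; abel
      rw [this]
      refine (norm_add_le _ _).trans ?_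
      rw [norm_smul, norm_smul, Real.norm_eq_abs, Real.norm_eq_abs, abs_of_pos ht.1,
        abs_of_nonneg (by linarith)]
      have e1 : t * ‖a - x‖ ≤ 1 * ρ := by gcongr; exact ht.2.le
      have e2 : (t - ⌊t / ρ⌋₊ * ρ) * ‖x‖ ≤ ρ * 2 := by
        gcongr; linarith
      linarith
  rw [sphereMeasure_apply measurableSet_closedBall]
  have hball : ∀ j : ℕ, (volume : Measure (EuclideanSpace ℝ (Fin d)))
      (Metric.closedBall ((j * ρ) • x) (3 * ρ)) = ENNReal.ofReal ((3 * ρ) ^ d * V) := by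
    intro j
    rw [Measure.addHaar_closedBall' _ _ (by positivity), finrank_euclideanSpace_fin, hV,
      ENNReal.ofReal_mul (by positivity), ofReal_measureReal measure_closedBall_lt_top.ne]
  have hvol : (volume : Measure (EuclideanSpace ℝ (Fin d)))
      (Set.Ioo (0 : ℝ) 1 • (Metric.closedBall x ρ ∩ Metric.sphere 0 1)) ≤
      ENNReal.ofReal (2 * 3 ^ d * V * ρ ^ (d - 1)) := by
    refine (measure_mono hcover).trans ((measure_biUnion_finset_le _ _).trans ?_)
    simp only [hball, Finset.sum_const, Finset.card_range, nsmul_eq_mul]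
    rw [← ENNReal.ofReal_natCast, ← ENNReal.ofReal_mul (by positivity)]
    apply ENNReal.ofReal_le_ofReal
    have hfl : ((⌊1 / ρ⌋₊ + 1 : ℕ) : ℝ) ≤ 2 / ρ := by
      push_cast
      have h2 := Nat.floor_le (a := 1 / ρ) (by positivity)
      have h3 : 1 ≤ 1 / ρ := by rw [le_div_iff₀ hρ]; linarith
      calc (⌊1 / ρ⌋₊ : ℝ) + 1 ≤ 1 / ρ + 1 / ρ := by linarith
        _ = 2 / ρ := by ring
    calc _ ≤ 2 / ρ * ((3 * ρ) ^ d * V) := by gcongr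
      _ = _ := by
        obtain ⟨n, rfl⟩ : ∃ n, d = n + 1 := ⟨d - 1, by omega⟩
        rw [Nat.add_sub_cancel, mul_pow, pow_succ ρ]
        field_simp
  calc _ ≤ (d : ℝ≥0∞) * ENNReal.ofReal (2 * 3 ^ d * V * ρ ^ (d - 1)) := by gcongr
    _ = ENNReal.ofReal (d * (2 * 3 ^ d * V) * ρ ^ (d - 1)) := by
        rw [← ENNReal.ofReal_natCast, ← ENNReal.ofReal_mul (by positivity)]
        congr 1; ring
    _ ≤ _ := by
        apply ENNReal.ofReal_le_ofReal
        gcongr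
        linarith

/-- The cube of side `2 r` centred at `η`. -/
def cube {d : ℕ} (η : Fin d → ℝ) (r : ℝ) : Set (EuclideanSpace ℝ (Fin d)) :=
  {ξ | ∀ i, |ξ i - η i| ≤ r}

theorem measurableSet_cube {d : ℕ} (η : Fin d → ℝ) (r : ℝ) : MeasurableSet (cube η r) := by
  have : cube η r = ⋂ i, {ξ : EuclideanSpace ℝ (Fin d) | |ξ i - η i| ≤ r} := by
    ext; simp [cube]
  rw [this]
  refine MeasurableSet.iInter fun i => measurableSet_le ?_ measurable_const
  fun_prop

theorem norm_le_sqrt_mul_of_forall_abs_le {d : ℕ} {x : EuclideanSpace ℝ (Fin d)} {r : ℝ}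
    (hr : 0 ≤ r) (h : ∀ i, |x i| ≤ r) : ‖x‖ ≤ Real.sqrt d * r := by
  rw [EuclideanSpace.norm_eq]
  refine Real.sqrt_le_iff.2 ⟨by positivity, ?_⟩
  rw [mul_pow, Real.sq_sqrt (by positivity)]
  calc ∑ i, ‖x i‖ ^ 2 ≤ ∑ _i : Fin d, r ^ 2 := by
        refine Finset.sum_le_sum fun i _ => ?_
        rw [Real.norm_eq_abs]
        exact pow_le_pow_left₀ (abs_nonneg _) (h i) 2
    _ = d * r ^ 2 := by simp

theorem exists_sphereMeasure_cube_le (d : ℕ) (hd : 1 ≤ d) :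
    ∃ C : ℝ, 0 < C ∧ ∀ (η : Fin d → ℝ) (r : ℝ), 0 < r →
      sphereMeasure d (cube η r) ≤ ENNReal.ofReal (C * r ^ (d - 1)) := by
  obtain ⟨C, hC, h⟩ := exists_sphereMeasure_closedBall_le d hd
  refine ⟨C * Real.sqrt d ^ (d - 1), by positivity, fun η r hr => ?_⟩
  have hd' : 0 < Real.sqrt d := Real.sqrt_pos.2 (by exact_mod_cast hd)
  have hsub : cube η r ⊆ Metric.closedBall (WithLp.toLp 2 η) (Real.sqrt d * r) := by
    intro ξ hξ
    rw [mem_closedBall_iff_norm]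
    exact norm_le_sqrt_mul_of_forall_abs_le hr.le fun i => by simpa using hξ i
  refine (measure_mono hsub).trans ((h _ _ (by positivity)).trans (le_of_eq ?_))
  rw [mul_pow, mul_assoc]

/-! ### Dual lattice points near the sphere -/

/-- The steps of the anisotropic lattice: `N` in every direction but the last, where it is
`N²`. -/
def latticeStep (d : ℕ) (N : ℝ) (i : Fin d) : ℝ := if (i : ℕ) < d - 1 then N else N ^ 2

theorem latticeStep_pos {d : ℕ} {N : ℝ} (hN : 0 < N) (i : Fin d) : 0 < latticeStep d N i := by
  unfold latticeStep; split_ifs <;> positivity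

theorem latticeStep_castSucc {n : ℕ} {N : ℝ} (i : Fin n) :
    latticeStep (n + 1) N i.castSucc = N := by
  simp [latticeStep]

theorem latticeStep_last {n : ℕ} {N : ℝ} : latticeStep (n + 1) N (Fin.last n) = N ^ 2 := by
  simp [latticeStep]

theorem prod_latticeStep {n : ℕ} {N : ℝ} : ∏ i, latticeStep (n + 1) N i = N ^ (n + 2) := by
  rw [Fin.prod_univ_castSucc]
  simp only [latticeStep_castSucc, latticeStep_last, Finset.prod_const, Finset.card_univ,
    Fintype.card_fin]
  ring

/-- Points of a translate of the dual lattice that lie within `r` of the unit sphere. -/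
theorem exists_card_near_sphere_le (n : ℕ) {ε : ℝ} (hε : 0 < ε) :
    ∃ C : ℝ, 1 ≤ C ∧ ∀ (N R r : ℝ) (u : Fin (n + 2) → ℝ), 1 ≤ N → N ^ 200 ≤ R → 0 ≤ r → r ≤ 1 / R →
      (∀ i, u i ∈ Set.Icc (0 : ℝ) 1) → ∀ S : Finset (Fin (n + 2) → ℤ),
      (∀ k ∈ S, ∃ ξ ∈ cube (fun i => (u i + k i) / latticeStep (n + 2) N i) r, ‖ξ‖ = 1) →
      (S.card : ℝ) ≤ C * N ^ n * R ^ ε := by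
  classical
  obtain ⟨C, hC1, hC⟩ := exists_card_near_circle_le (A := 3 * (n + 2)) hε (by positivity)
  refine ⟨7 ^ n * C, one_le_mul_of_one_le_of_one_le (one_le_pow₀ (by norm_num)) hC1, ?_⟩
  intro N R r u hN hNR hr0 hrR hu S hS
  have hNpos : 0 < N := by linarith
  have hR1 : 1 ≤ R := (one_le_pow₀ hN).trans hNR
  have hRpos : 0 < R := by linarith
  have hr1 : r ≤ 1 := hrR.trans (by rw [div_le_one hRpos]; exact hR1)
  set s := latticeStep (n + 2) N with hs
  have hnear : ∀ k ∈ S, (∀ i, |(u i + k i) / s i| ≤ 2) ∧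
      |∑ i, ((u i + k i) / s i) ^ 2 - 1| ≤ 3 * (n + 2) / R := by
    intro k hk
    obtain ⟨ξ, hξ, hξ1⟩ := hS k hk
    have hξi : ∀ i, |ξ i| ≤ 1 := fun i => by
      rw [← hξ1]; exact PiLp.norm_apply_le ξ i
    have hη : ∀ i, |(u i + k i) / s i| ≤ 2 := fun i => by
      have h1 := hξ i
      have h2 := hξi i
      rw [abs_le] at h1 h2 ⊢
      constructor <;> linarith [h1.1, h1.2, h2.1, h2.2]
    refine ⟨hη, ?_⟩
    have hsum : ∑ i, (ξ i) ^ 2 = 1 := by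
      rw [← EuclideanSpace.real_norm_sq_eq, hξ1, one_pow]
    rw [← hsum, ← Finset.sum_sub_distrib]
    calc _ ≤ ∑ i, |((u i + k i) / s i) ^ 2 - ξ i ^ 2| := Finset.abs_sum_le_sum_abs _ _
      _ ≤ ∑ _i : Fin (n + 2), 3 / R := by
          refine Finset.sum_le_sum fun i _ => ?_
          have h1 := hξ i
          rw [abs_sub_comm] at h1
          have : ((u i + k i) / s i) ^ 2 - ξ i ^ 2
            = ((u i + k i) / s i - ξ i) * ((u i + k i) / s i + ξ i) := by ring
          rw [this, abs_mul]
          have h3 : |(u i + k i) / s i + ξ i| ≤ 3 :=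
            (abs_add_le _ _).trans (by linarith [hη i, hξi i])
          calc _ ≤ (1 / R) * 3 := by gcongr; exact h1.trans hrR
            _ = 3 / R := by ring
      _ = _ := by
          rw [Finset.sum_const, Finset.card_univ, Fintype.card_fin]; simp; ring
  -- Projection to the first n coordinates, all of step 1/N, with at most 7N values each. A fibre is
  -- a planar problem in one direction of step 1/N and one of step 1/N², to which the circle bound
  -- applies uniformly in the radius.
  set π : (Fin (n + 2) → ℤ) → (Fin n → ℤ) := fun k i => k i.castSucc.castSucc with hπ
  have hmaps : ∀ k ∈ S, π k ∈ Fintype.piFinset fun _ : Fin n =>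
      Finset.Icc (-⌊3 * N⌋) ⌊3 * N⌋ := by
    intro k hk
    rw [Fintype.mem_piFinset]
    intro i
    have h1 := (hnear k hk).1 i.castSucc.castSucc
    rw [hs, latticeStep_castSucc, abs_div, abs_of_pos hNpos, div_le_iff₀ hNpos] at h1
    have h2 := hu i.castSucc.castSucc
    rw [abs_le] at h1
    rw [Finset.mem_Icc, Int.le_floor, neg_le, Int.le_floor]
    push_cast
    simp only [hπ]
    constructor <;> linarith [h1.1, h1.2, h2.1, h2.2]
  rw [Finset.card_eq_sum_card_fiberwise hmaps]
  push_cast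
  have hfib : ∀ t : Fin n → ℤ, ((S.filter (fun k => π k = t)).card : ℝ) ≤ C * R ^ ε := by
    intro t
    have hinj : Set.InjOn (fun k : Fin (n + 2) → ℤ => (k (Fin.last n).castSucc, k (Fin.last (n + 1))))
        (S.filter (fun k => π k = t)) := by
      intro k hk k' hk' h
      simp only [Finset.coe_filter, Set.mem_ofPred_eq] at hk hk'
      simp only [Prod.mk.injEq] at h
      funext i
      refine Fin.lastCases h.2 (fun j => Fin.lastCases h.1 (fun l => ?_) j) i
      exact congrFun (hk.2.trans hk'.2.symm) l
    rw [← Finset.card_image_of_injOn hinj]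
    have hs1 : s (Fin.last n).castSucc = N := latticeStep_castSucc _
    have hs2 : s (Fin.last (n + 1)) = N ^ 2 := latticeStep_last
    refine hC N R (u (Fin.last n).castSucc / N) (u (Fin.last (n + 1)) / N ^ 2)
      (1 - ∑ i : Fin n, ((u i.castSucc.castSucc + t i) / N) ^ 2) hN hNR ?_ ?_ _ ?_
    · have := hu (Fin.last n).castSucc
      exact ⟨div_nonneg this.1 hNpos.le, div_le_one_of_le₀ (this.2.trans hN) hNpos.le⟩
    · have := hu (Fin.last (n + 1))
      exact ⟨div_nonneg this.1 (by positivity),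
        div_le_one_of_le₀ (this.2.trans (one_le_pow₀ hN)) (by positivity)⟩
    · intro P hP
      obtain ⟨k, hk, rfl⟩ := Finset.mem_image.1 hP
      rw [Finset.mem_filter] at hk
      obtain ⟨h1, h2⟩ := hnear k hk.1
      have e1 := h1 (Fin.last n).castSucc
      have e2 := h1 (Fin.last (n + 1))
      rw [hs1, add_div] at e1
      rw [hs2, add_div] at e2
      refine ⟨e1, e2, ?_⟩
      rw [Fin.sum_univ_castSucc, Fin.sum_univ_castSucc, hs1, hs2] at h2
      have e3 : ∀ i : Fin n, ((u i.castSucc.castSucc + k i.castSucc.castSucc) /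
          s i.castSucc.castSucc) ^ 2 = ((u i.castSucc.castSucc + t i) / N) ^ 2 := by
        intro i
        rw [hs, latticeStep_castSucc, ← hk.2]
      simp only [e3] at h2
      rw [add_div, add_div] at h2
      convert h2 using 2
      ring
  calc _ ≤ ∑ _t ∈ Fintype.piFinset fun _ : Fin n => Finset.Icc (-⌊3 * N⌋) ⌊3 * N⌋, C * R ^ ε :=
        Finset.sum_le_sum fun t _ => hfib t
    _ = ((Finset.Icc (-⌊3 * N⌋) ⌊3 * N⌋).card : ℝ) ^ n * (C * R ^ ε) := by
        rw [Finset.sum_const, Fintype.card_piFinset]; simp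
    _ ≤ (7 * N) ^ n * (C * R ^ ε) := by
        have := card_int_le_of_forall_abs_le (x := 3 * N) (Finset.Icc (-⌊3 * N⌋) ⌊3 * N⌋) (by
          intro m hm
          rw [Finset.mem_Icc, Int.le_floor, neg_le, Int.le_floor] at hm
          push_cast at hm
          rw [abs_le]; constructor <;> linarith [hm.1, hm.2]) (by positivity)
        gcongr
        linarith
    _ = _ := by rw [mul_pow]; ring

/-- The measure of the sphere inside a periodic family of small cubes. -/
theorem exists_tsum_sphereMeasure_cube_le (n : ℕ) {ε : ℝ} (hε : 0 < ε) :
    ∃ C : ℝ, 0 < C ∧ ∀ (N R r : ℝ) (u : Fin (n + 2) → ℝ), 1 ≤ N → N ^ 200 ≤ R → 0 < r → r ≤ 1 / R →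
      (∀ i, u i ∈ Set.Icc (0 : ℝ) 1) →
      ∑' k : Fin (n + 2) → ℤ,
        sphereMeasure (n + 2) (cube (fun i => (u i + k i) / latticeStep (n + 2) N i) r) ≤
        ENNReal.ofReal (C * r ^ (n + 1) * N ^ n * R ^ ε) := by
  classical
  obtain ⟨C₁, hC₁, h₁⟩ := exists_card_near_sphere_le n hε
  obtain ⟨C₂, hC₂, h₂⟩ := exists_sphereMeasure_cube_le (n + 2) (by omega)
  refine ⟨C₁ * C₂, by positivity, ?_⟩
  intro N R r u hN hNR hr hrR hu
  rw [ENNReal.tsum_eq_iSup_sum]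
  refine iSup_le fun S => ?_
  set Q : (Fin (n + 2) → ℤ) → Set (EuclideanSpace ℝ (Fin (n + 2))) :=
    fun k => cube (fun i => (u i + k i) / latticeStep (n + 2) N i) r with hQ
  -- Cubes that miss the sphere carry no mass, so only the counted ones contribute.
  have hzero : ∀ k ∈ S, k ∉ S.filter (fun k => ∃ ξ ∈ Q k, ‖ξ‖ = 1) →
      sphereMeasure (n + 2) (Q k) = 0 := by
    intro k hk hk'
    have h3 : ∀ ξ ∈ Q k, ‖ξ‖ ≠ 1 := by
      intro ξ hξ h1
      exact hk' (Finset.mem_filter.2 ⟨hk, ξ, hξ, h1⟩)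
    refine measure_mono_null (t := {ξ | ¬ ‖ξ‖ = 1}) h3 ?_
    exact ae_iff.1 (ae_sphereMeasure_norm_eq_one (n + 2))
  rw [← Finset.sum_subset (Finset.filter_subset _ _) hzero]
  have hcard := h₁ N R r u hN hNR hr.le hrR hu (S.filter (fun k => ∃ ξ ∈ Q k, ‖ξ‖ = 1))
    (fun k hk => (Finset.mem_filter.1 hk).2)
  have hRpos : 0 < R := by linarith [(one_le_pow₀ hN : 1 ≤ N ^ 200)]
  calc _ ≤ ∑ _k ∈ S.filter (fun k => ∃ ξ ∈ Q k, ‖ξ‖ = 1), ENNReal.ofReal (C₂ * r ^ (n + 1)) :=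
        Finset.sum_le_sum fun k _ => h₂ _ r hr
    _ = ENNReal.ofReal ((S.filter (fun k => ∃ ξ ∈ Q k, ‖ξ‖ = 1)).card * (C₂ * r ^ (n + 1))) := by
        rw [Finset.sum_const, nsmul_eq_mul, ENNReal.ofReal_mul (Nat.cast_nonneg _),
          ENNReal.ofReal_natCast]
    _ ≤ _ := by
        apply ENNReal.ofReal_le_ofReal
        calc _ ≤ (C₁ * N ^ n * R ^ ε) * (C₂ * r ^ (n + 1)) := by gcongr
          _ = _ := by ring

/-! ### Exponentials and Parseval's identity -/

/-- `e(t) = exp (2πi t)`. -/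
noncomputable def unitExp (t : ℝ) : ℂ := Complex.exp (2 * Real.pi * Complex.I * (t : ℂ))

theorem unitExp_add (s t : ℝ) : unitExp (s + t) = unitExp s * unitExp t := by
  simp only [unitExp, ← Complex.exp_add]; congr 1; push_cast; ring

theorem unitExp_eq_exp_mul_I (t : ℝ) : unitExp t = Complex.exp ((2 * Real.pi * t : ℝ) * Complex.I) := by
  rw [unitExp]; congr 1; push_cast; ring

theorem norm_unitExp (t : ℝ) : ‖unitExp t‖ = 1 := by
  rw [unitExp_eq_exp_mul_I, Complex.norm_exp_ofReal_mul_I]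

theorem unitExp_intCast (k : ℤ) : unitExp k = 1 := by
  rw [unitExp, Complex.exp_eq_one_iff]; exact ⟨k, by push_cast; ring⟩

theorem unitExp_zero : unitExp 0 = 1 := by simpa using unitExp_intCast 0

theorem conj_unitExp (t : ℝ) : (starRingEnd ℂ) (unitExp t) = unitExp (-t) := by
  rw [unitExp, ← Complex.exp_conj, unitExp]; congr 1; simp [Complex.conj_ofNat]

theorem continuous_unitExp : Continuous unitExp := by unfold unitExp; fun_prop

theorem unitExp_sum {ι : Type*} (s : Finset ι) (f : ι → ℝ) :
    unitExp (∑ i ∈ s, f i) = ∏ i ∈ s, unitExp (f i) := by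
  classical
  induction s using Finset.induction_on with
  | empty => simp [unitExp_zero]
  | insert a s ha ih => rw [Finset.sum_insert ha, Finset.prod_insert ha, unitExp_add, ih]

/-- Here |2πt| ≤ 1 and cos s ≥ 1 - s²/2. This is the no-cancellation criterion behind both the
smearing argument and the lower bound. -/
theorem re_unitExp_ge {t : ℝ} (ht : |t| ≤ 1 / 8) : 1 / 2 ≤ (unitExp t).re := by
  rw [unitExp_eq_exp_mul_I, Complex.exp_ofReal_mul_I_re]
  have h1 : |2 * Real.pi * t| ≤ 1 := by
    rw [abs_mul, abs_of_pos Real.two_pi_pos]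
    nlinarith [Real.pi_lt_d2, Real.pi_pos, abs_nonneg t]
  have h2 := Real.one_sub_sq_div_two_le_cos (x := 2 * Real.pi * t)
  have h3 : (2 * Real.pi * t) ^ 2 ≤ 1 := by
    rw [← sq_abs]; exact pow_le_one₀ (abs_nonneg _) h1
  linarith

theorem integral_Ico_unitExp (k : ℤ) :
    ∫ t in Set.Ico (0 : ℝ) 1, unitExp (k * t) = if k = 0 then 1 else 0 := by
  rw [integral_Ico_eq_integral_Ioc, ← intervalIntegral.integral_of_le zero_le_one]
  split_ifs with hk
  · subst hk; simp [unitExp_zero]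
  · have hc : (2 * Real.pi * Complex.I * k : ℂ) ≠ 0 := by
      have : (k : ℂ) ≠ 0 := by exact_mod_cast hk
      exact mul_ne_zero Complex.two_pi_I_ne_zero this
    have h := integral_exp_mul_complex (a := 0) (b := 1) hc
    have h2 : ∀ t : ℝ, unitExp (k * t) = Complex.exp (2 * Real.pi * Complex.I * k * t) := by
      intro t; rw [unitExp]; congr 1; push_cast; ring
    simp only [h2]
    rw [h]
    have h3 : Complex.exp (2 * Real.pi * Complex.I * k * (1 : ℝ)) = 1 := by
      rw [← h2, mul_one, unitExp_intCast]
    rw [h3]; simp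

theorem integral_unitBox_unitExp {d : ℕ} (k : Fin d → ℤ) :
    ∫ v in Set.univ.pi fun _ : Fin d => Set.Ico (0 : ℝ) 1, unitExp (∑ i, k i * v i)
      = if k = 0 then 1 else 0 := by
  rw [volume_pi, Measure.restrict_pi_pi]
  simp only [unitExp_sum]
  rw [integral_fintype_prod_eq_prod (f := fun i t => unitExp (k i * t))]
  simp only [integral_Ico_unitExp]
  split_ifs with h
  · subst h; simp
  · obtain ⟨i, hi⟩ := Function.ne_iff.1 h
    exact Finset.prod_eq_zero (Finset.mem_univ i) (by simpa using hi)

/-- Parseval's identity for trigonometric polynomials on the unit box. -/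
theorem lintegral_unitBox_trigPoly {d : ℕ} {ι : Type*} (T : Finset ι) (m : ι → Fin d → ℤ)
    (hm : Set.InjOn m T) (b : ι → ℂ) :
    ∫⁻ v in Set.univ.pi fun _ : Fin d => Set.Ico (0 : ℝ) 1,
      ‖∑ j ∈ T, b j * unitExp (∑ i, m j i * v i)‖ₑ ^ 2 = ∑ j ∈ T, ‖b j‖ₑ ^ 2 := by
  classical
  set D : Set (Fin d → ℝ) := Set.univ.pi fun _ : Fin d => Set.Ico (0 : ℝ) 1 with hD
  set h : (Fin d → ℝ) → ℂ := fun v => ∑ j ∈ T, b j * unitExp (∑ i, m j i * v i) with hh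
  have hfin : IsFiniteMeasure (volume.restrict D) := by
    refine ⟨?_⟩
    rw [Measure.restrict_apply_univ, hD, Real.volume_pi_Ico]
    simp
  have hcont : Continuous h := by
    have := continuous_unitExp
    rw [hh]; fun_prop
  have hbd : ∀ v, ‖h v‖ ≤ ∑ j ∈ T, ‖b j‖ := fun v => by
    refine (norm_sum_le _ _).trans (Finset.sum_le_sum fun j _ => ?_)
    rw [norm_mul, norm_unitExp, mul_one]
  have hint : Integrable (fun v => ‖h v‖ ^ 2) (volume.restrict D) := by
    refine Integrable.of_bound (C := (∑ j ∈ T, ‖b j‖) ^ 2)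
      (by fun_prop) (Filter.Eventually.of_forall fun v => ?_)
    rw [Real.norm_eq_abs, abs_of_nonneg (by positivity)]
    exact pow_le_pow_left₀ (norm_nonneg _) (hbd v) 2
  have hterm : ∀ j l : ι, Integrable (fun v : Fin d → ℝ => b j * (starRingEnd ℂ) (b l) *
      unitExp (∑ i, (m j - m l) i * v i)) (volume.restrict D) := by
    intro j l
    refine Integrable.of_bound (C := ‖b j * (starRingEnd ℂ) (b l)‖) ?_
      (Filter.Eventually.of_forall fun v => ?_)
    · have := continuous_unitExp
      exact Continuous.aestronglyMeasurable (by fun_prop)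
    · rw [norm_mul, norm_unitExp, mul_one]
  have hexp : ∀ v, ((‖h v‖ ^ 2 : ℝ) : ℂ) = ∑ j ∈ T, ∑ l ∈ T, b j * (starRingEnd ℂ) (b l) *
      unitExp (∑ i, (m j - m l) i * v i) := by
    intro v
    push_cast
    rw [← Complex.mul_conj']
    simp only [hh, map_sum, map_mul, conj_unitExp]
    rw [Finset.sum_mul_sum]
    refine Finset.sum_congr rfl fun j _ => Finset.sum_congr rfl fun l _ => ?_
    rw [mul_mul_mul_comm, ← unitExp_add]
    congr 2
    rw [← Finset.sum_neg_distrib, ← Finset.sum_add_distrib]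
    refine Finset.sum_congr rfl fun i _ => ?_
    simp only [Pi.sub_apply]; push_cast; ring
  have hval : ∫ v in D, ‖h v‖ ^ 2 = ∑ j ∈ T, ‖b j‖ ^ 2 := by
    have : ((∫ v in D, ‖h v‖ ^ 2 : ℝ) : ℂ) = ((∑ j ∈ T, ‖b j‖ ^ 2 : ℝ) : ℂ) := by
      rw [← integral_complex_ofReal]
      simp only [hexp]
      rw [integral_finsetSum _ (fun j _ => integrable_finsetSum _ fun l _ => hterm j l)]
      push_cast
      refine Finset.sum_congr rfl fun j hj => ?_
      rw [integral_finsetSum _ (fun l _ => hterm j l)]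
      simp only [integral_const_mul, hD, integral_unitBox_unitExp]
      rw [Finset.sum_eq_single j]
      · simp [Complex.mul_conj']
      · intro l hl hlj
        rw [if_neg, mul_zero]
        rw [sub_eq_zero]
        exact fun h => hlj (hm hl hj h.symm)
      · exact fun h => absurd hj h
    exact_mod_cast this
  have hen : ∀ z : ℂ, ‖z‖ₑ ^ 2 = ENNReal.ofReal (‖z‖ ^ 2) := fun z => by
    rw [ENNReal.ofReal_pow (norm_nonneg _), ofReal_norm]
  simp only [hen]
  rw [← ENNReal.ofReal_sum_of_nonneg (fun _ _ => by positivity), ← hval,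
    ofReal_integral_eq_lintegral_ofReal hint (Filter.Eventually.of_forall fun _ => by positivity)]

theorem sq_lintegral_le {α : Type*} [MeasurableSpace α] (μ : Measure α) {f : α → ℝ≥0∞}
    (hf : AEMeasurable f μ) : (∫⁻ x, f x ∂μ) ^ 2 ≤ μ Set.univ * ∫⁻ x, f x ^ 2 ∂μ := by
  have h := ENNReal.lintegral_mul_le_Lp_mul_Lq μ Real.HolderConjugate.two_two
    (f := fun _ => 1) aemeasurable_const hf
  simp only [Pi.mul_apply, one_mul, lintegral_const, ENNReal.rpow_two, one_pow] at h
  calc (∫⁻ x, f x ∂μ) ^ 2 ≤ (μ Set.univ ^ (1 / (2 : ℝ)) * (∫⁻ x, f x ^ 2 ∂μ) ^ (1 / (2 : ℝ))) ^ 2 := by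
        gcongr
    _ = _ := by
        rw [mul_pow, ← ENNReal.rpow_natCast, ← ENNReal.rpow_natCast, ← ENNReal.rpow_mul,
          ← ENNReal.rpow_mul]
        norm_num

/-! ### Smearing, periodisation and duality -/

/-- Splitting an integral over `ℝ^d` into integrals over the translates of the unit box. -/
theorem lintegral_eq_tsum_unitBox {d : ℕ} (F : (Fin d → ℝ) → ℝ≥0∞) :
    ∫⁻ w, F w = ∑' k : Fin d → ℤ, ∫⁻ v in Set.univ.pi fun _ : Fin d => Set.Ico (0 : ℝ) 1,
      F (fun i => v i + k i) := by
  set s : (Fin d → ℤ) → Set (Fin d → ℝ) := fun k => {w | ∀ i, ⌊w i⌋ = k i} with hs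
  have hmeas : ∀ k, MeasurableSet (s k) := by
    intro k
    have : s k = ⋂ i, {w : Fin d → ℝ | ⌊w i⌋ = k i} := by ext; simp [hs]
    rw [this]
    exact MeasurableSet.iInter fun i =>
      (measurableSet_singleton (k i)).preimage (Int.measurable_floor.comp (measurable_pi_apply i))
  have hdisj : Pairwise (Function.onFun Disjoint s) := by
    intro k l hkl
    rw [Function.onFun, Set.disjoint_left]
    intro w hk hl
    exact hkl (funext fun i => (hk i).symm.trans (hl i))
  have hcov : ⋃ k, s k = Set.univ :=
    Set.eq_univ_of_forall fun w => Set.mem_iUnion.2 ⟨fun i => ⌊w i⌋, fun i => rfl⟩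
  have hbox : (Set.univ.pi fun _ : Fin d => Set.Ico (0 : ℝ) 1) = s 0 := by
    ext w
    simp [hs, Int.floor_eq_zero_iff]
  rw [← setLIntegral_univ, ← hcov, lintegral_iUnion hmeas hdisj]
  congr 1
  funext k
  rw [hbox, ← lintegral_indicator (hmeas k), ← lintegral_indicator (hmeas 0),
    ← lintegral_add_right_eq_self _ (fun i => (k i : ℝ))]
  congr 1
  funext v
  have hiff : v + (fun i => (k i : ℝ)) ∈ s k ↔ v ∈ s 0 := by
    simp [hs]
  by_cases h : v ∈ s 0
  · rw [Set.indicator_of_mem (hiff.2 h), Set.indicator_of_mem h]; rfl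
  · rw [Set.indicator_of_notMem (fun h' => h (hiff.1 h')), Set.indicator_of_notMem h]

set_option maxHeartbeats 1000000 in
/-- The dual estimate: the `L²(σ)` norm of a trigonometric polynomial with anisotropic frequencies
is controlled by the `σ`-measure of a periodic family of small cubes. -/
theorem lintegral_trigPoly_le {d : ℕ} {ι : Type*} (T : Finset ι) (m : ι → Fin d → ℤ)
    (hm : Set.InjOn m T) (a : ι → ℂ) (s : Fin d → ℝ) (hs : ∀ i, 0 < s i) {r : ℝ} (hr : 0 < r)
    (σ : Measure (EuclideanSpace ℝ (Fin d))) [SFinite σ]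
    (hT : ∀ j ∈ T, ∀ v : Fin d → ℝ, (∀ i, |v i| ≤ r * s i) → |∑ i, m j i * v i| ≤ 1 / 8)
    {W : ℝ≥0∞} (hW : ∀ u : Fin d → ℝ, (∀ i, u i ∈ Set.Icc (0 : ℝ) 1) →
      ∑' k : Fin d → ℤ, σ (cube (fun i => (u i + k i) / s i) r) ≤ W) :
    ENNReal.ofReal (∏ i, 2 * (r * s i)) *
      ∫⁻ ξ, ‖∑ j ∈ T, a j * unitExp (∑ i, m j i * (s i * ξ i))‖ₑ ^ 2 ∂σ ≤
      4 * W * ∑ j ∈ T, ‖a j‖ₑ ^ 2 := by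
  classical
  set B : Set (Fin d → ℝ) := Set.univ.pi fun i => Set.Icc (-(r * s i)) (r * s i) with hB
  have hBm : MeasurableSet B := MeasurableSet.univ_pi fun _ => measurableSet_Icc
  have hmemB : ∀ v, v ∈ B ↔ ∀ i, |v i| ≤ r * s i := fun v => by
    simp only [hB, Set.mem_univ_pi, Set.mem_Icc, abs_le]
  set V : ℝ := ∏ i, 2 * (r * s i) with hV
  have hVpos : 0 < V := Finset.prod_pos fun i _ => by have := hs i; positivity
  have hBV : volume B = ENNReal.ofReal V := by
    rw [hB, volume_pi_pi, hV, ENNReal.ofReal_prod_of_nonneg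
      (fun i _ => by have := hs i; positivity)]
    refine Finset.prod_congr rfl fun i _ => ?_
    rw [Real.volume_Icc]; congr 1; ring
  have hBV' : volume.real B = V := by
    rw [Measure.real, hBV, ENNReal.toReal_ofReal hVpos.le]
  have hBfin : IsFiniteMeasure (volume.restrict B) := by
    refine ⟨?_⟩
    rw [Measure.restrict_apply_univ, hBV]; exact ENNReal.ofReal_lt_top
  have hue := continuous_unitExp
  have hint : ∀ j, Integrable (fun v : Fin d → ℝ => unitExp (∑ i, m j i * v i))
      (volume.restrict B) := fun j => by
    refine Integrable.of_bound (C := 1) (Continuous.aestronglyMeasurable (by fun_prop))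
      (Filter.Eventually.of_forall fun v => ?_)
    rw [norm_unitExp]
  -- The multiplier by which averaging over the box B acts on the j-th exponential. By `hT` the
  -- phases on B stay within 1/8, so it is at least 1/2 in modulus and may be divided out: averaging
  -- h, with coefficients a / κ, returns g exactly.
  set κ : ι → ℂ := fun j => V⁻¹ * ∫ v in B, unitExp (∑ i, m j i * v i) with hκ
  have hκhalf : ∀ j ∈ T, 1 / 2 ≤ ‖κ j‖ := by
    intro j hj
    have h1 : V * (1 / 2) ≤ (∫ v in B, unitExp (∑ i, m j i * v i)).re := by
      have h2 := integral_re (𝕜 := ℂ) (hint j)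
      simp only [RCLike.re_to_complex] at h2
      rw [← h2, ← hBV']
      have h3 : ∫ _v in B, (1 / 2 : ℝ) = volume.real B * (1 / 2) := by
        rw [setIntegral_const, smul_eq_mul]
      rw [← h3]
      refine setIntegral_mono_on (integrable_const _) (hint j).re hBm fun v hv => ?_
      exact re_unitExp_ge (hT j hj v ((hmemB v).1 hv))
    have h4 : V * (1 / 2) ≤ ‖∫ v in B, unitExp (∑ i, m j i * v i)‖ :=
      h1.trans (Complex.re_le_norm _)
    rw [hκ]
    simp only [norm_mul, norm_inv, Complex.norm_real, Real.norm_eq_abs, abs_of_pos hVpos]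
    rw [inv_mul_eq_div, le_div_iff₀ hVpos]
    linarith
  set b : ι → ℂ := fun j => a j / κ j with hb
  set h : (Fin d → ℝ) → ℂ := fun v => ∑ j ∈ T, b j * unitExp (∑ i, m j i * v i) with hh
  have hcont : Continuous h := by rw [hh]; fun_prop
  set g : EuclideanSpace ℝ (Fin d) → ℂ :=
    fun ξ => ∑ j ∈ T, a j * unitExp (∑ i, m j i * (s i * ξ i)) with hg
  have hrep : ∀ ξ : EuclideanSpace ℝ (Fin d), ∫ v in B, h (fun i => s i * ξ i + v i) = V * g ξ := by
    intro ξ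
    simp only [hh, hg, mul_add, Finset.sum_add_distrib, unitExp_add]
    rw [integral_finsetSum _ (fun j _ => ((hint j).const_mul _).const_mul _), Finset.mul_sum]
    refine Finset.sum_congr rfl fun j hj => ?_
    rw [integral_const_mul, integral_const_mul]
    have h1 : ∫ v in B, unitExp (∑ i, m j i * v i) = V * κ j := by
      have : (V : ℂ) ≠ 0 := by exact_mod_cast hVpos.ne'
      simp only [hκ, Complex.ofReal_inv]; rw [mul_inv_cancel_left₀ this]
    have h2 : κ j ≠ 0 := by
      intro h0; have := hκhalf j hj; rw [h0, norm_zero] at this; norm_num at this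
    rw [h1, hb]
    field_simp
  set E : Set ((Fin d → ℝ) × EuclideanSpace ℝ (Fin d)) :=
    {p | ∀ i, |p.1 i - s i * p.2 i| ≤ r * s i} with hE
  have hEm : MeasurableSet E := by
    have : E = ⋂ i, {p : (Fin d → ℝ) × EuclideanSpace ℝ (Fin d) |
        |p.1 i - s i * p.2 i| ≤ r * s i} := by ext; simp [hE]
    rw [this]
    refine MeasurableSet.iInter fun i => measurableSet_le ?_ measurable_const
    fun_prop
  have hEcube : ∀ w, {ξ | (w, ξ) ∈ E} = cube (fun i => w i / s i) r := by
    intro w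
    ext ξ
    simp only [hE, cube, Set.mem_ofPred_eq]
    refine forall_congr' fun i => ?_
    have h1 : w i - s i * ξ i = s i * -(ξ i - w i / s i) := by
      have := (hs i).ne'
      field_simp; ring
    rw [h1, abs_mul, abs_neg, abs_of_pos (hs i), mul_comm r]
    exact mul_le_mul_iff_right₀ (hs i)
  -- Cauchy–Schwarz on the box. The set E couples w with those ξ whose box contains w, so that
  -- Fubini turns the integral over ξ into the σ-mass of a cube.
  have hpoint : ∀ ξ, ENNReal.ofReal V * ‖g ξ‖ₑ ^ 2 ≤
      ∫⁻ w, E.indicator (fun p => ‖h p.1‖ₑ ^ 2) (w, ξ) := by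
    intro ξ
    have h1 : (ENNReal.ofReal V * ‖g ξ‖ₑ) ^ 2 ≤
        ENNReal.ofReal V * ∫⁻ v in B, ‖h (fun i => s i * ξ i + v i)‖ₑ ^ 2 := by
      have h2 : ENNReal.ofReal V * ‖g ξ‖ₑ = ‖∫ v in B, h (fun i => s i * ξ i + v i)‖ₑ := by
        rw [hrep, enorm_mul]
        congr 1
        rw [← ofReal_norm, Complex.norm_real, Real.norm_eq_abs, abs_of_pos hVpos]
      rw [h2, ← hBV, ← Measure.restrict_apply_univ]
      refine (pow_le_pow_left' (enorm_integral_le_lintegral_enorm _) 2).trans ?_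
      exact sq_lintegral_le _ (by
        have : Continuous fun v : Fin d → ℝ => h (fun i => s i * ξ i + v i) :=
          hcont.comp (by fun_prop)
        exact this.enorm.measurable.aemeasurable)
    have h3 : ∫⁻ v in B, ‖h (fun i => s i * ξ i + v i)‖ₑ ^ 2 =
        ∫⁻ w, E.indicator (fun p => ‖h p.1‖ₑ ^ 2) (w, ξ) := by
      rw [← lintegral_indicator hBm, ← lintegral_add_left_eq_self
        (fun w => E.indicator (fun p => ‖h p.1‖ₑ ^ 2) (w, ξ)) (fun i => s i * ξ i)]
      congr 1
      funext v
      have hiff : ((fun i => s i * ξ i) + v, ξ) ∈ E ↔ v ∈ B := by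
        rw [hmemB]; simp [hE]
      by_cases hv : v ∈ B
      · rw [Set.indicator_of_mem hv, Set.indicator_of_mem (hiff.2 hv)]; rfl
      · rw [Set.indicator_of_notMem hv, Set.indicator_of_notMem (fun h' => hv (hiff.1 h'))]
    rw [h3, mul_pow, sq (ENNReal.ofReal V), mul_assoc] at h1
    exact (ENNReal.mul_le_mul_iff_right (ENNReal.ofReal_pos.2 hVpos).ne' ENNReal.ofReal_ne_top).1 h1
  have hgm : Continuous g := by rw [hg]; fun_prop
  have hjoint : Measurable (E.indicator (fun p => ‖h p.1‖ₑ ^ 2)) :=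
    Measurable.indicator ((hcont.comp continuous_fst).enorm.measurable.pow_const 2) hEm
  have hcubem : Measurable fun w : Fin d → ℝ => σ (cube (fun i => w i / s i) r) := by
    simp only [← hEcube]
    exact measurable_measure_prodMk_left hEm
  -- In the rescaled variable w the frequencies are integer vectors, so h has period ℤ^d and the
  -- integral folds onto the unit box.
  have hper : ∀ (v : Fin d → ℝ) (k : Fin d → ℤ), h (fun i => v i + k i) = h v := by
    intro v k
    simp only [hh]
    refine Finset.sum_congr rfl fun j _ => ?_
    congr 1
    simp only [mul_add, Finset.sum_add_distrib, unitExp_add]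
    have : ∑ i, (m j i : ℝ) * k i = ((∑ i, m j i * k i : ℤ) : ℝ) := by push_cast; rfl
    rw [this, unitExp_intCast, mul_one]
  calc ENNReal.ofReal V * ∫⁻ ξ, ‖g ξ‖ₑ ^ 2 ∂σ = ∫⁻ ξ, ENNReal.ofReal V * ‖g ξ‖ₑ ^ 2 ∂σ := by
        rw [lintegral_const_mul]; exact hgm.enorm.measurable.pow_const 2
    _ ≤ ∫⁻ ξ, (∫⁻ w : Fin d → ℝ, E.indicator (fun p => ‖h p.1‖ₑ ^ 2) (w, ξ)) ∂σ :=
        lintegral_mono hpoint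
    _ = ∫⁻ w, ∫⁻ ξ, E.indicator (fun p => ‖h p.1‖ₑ ^ 2) (w, ξ) ∂σ :=
        lintegral_lintegral_swap
          (f := fun ξ w => E.indicator (fun p => ‖h p.1‖ₑ ^ 2) (w, ξ))
          (hjoint.comp measurable_swap).aemeasurable
    _ = ∫⁻ w, ‖h w‖ₑ ^ 2 * σ (cube (fun i => w i / s i) r) := by
        congr 1
        funext w
        have : ∀ ξ, E.indicator (fun p => ‖h p.1‖ₑ ^ 2) (w, ξ) =
            (cube (fun i => w i / s i) r).indicator (fun _ => ‖h w‖ₑ ^ 2) ξ := by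
          intro ξ
          rw [← hEcube]
          rfl
        simp only [this]
        rw [lintegral_indicator (measurableSet_cube _ _), setLIntegral_const]
    _ = ∑' k : Fin d → ℤ, ∫⁻ v in Set.univ.pi fun _ : Fin d => Set.Ico (0 : ℝ) 1,
          ‖h v‖ₑ ^ 2 * σ (cube (fun i => (v i + k i) / s i) r) := by
        rw [lintegral_eq_tsum_unitBox]
        simp only [hper]
    _ = ∫⁻ v in Set.univ.pi fun _ : Fin d => Set.Ico (0 : ℝ) 1,
          ‖h v‖ₑ ^ 2 * ∑' k : Fin d → ℤ, σ (cube (fun i => (v i + k i) / s i) r) := by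
        rw [← lintegral_tsum]
        · simp only [ENNReal.tsum_mul_left]
        · intro k
          refine Measurable.aemeasurable ?_
          have hshift : Measurable fun (v : Fin d → ℝ) i => v i + (k i : ℝ) := by fun_prop
          exact (hcont.enorm.measurable.pow_const 2).mul (hcubem.comp hshift)
    _ ≤ ∫⁻ v in Set.univ.pi fun _ : Fin d => Set.Ico (0 : ℝ) 1, ‖h v‖ₑ ^ 2 * W := by
        refine setLIntegral_mono' (MeasurableSet.univ_pi fun _ => measurableSet_Ico) fun v hv => ?_
        gcongr
        refine hW v fun i => Set.Ico_subset_Icc_self (hv i (Set.mem_univ i))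
    _ = (∑ j ∈ T, ‖b j‖ₑ ^ 2) * W := by
        rw [lintegral_mul_const _ (hcont.enorm.measurable.pow_const 2),
          lintegral_unitBox_trigPoly T m hm b]
    _ ≤ (∑ j ∈ T, 4 * ‖a j‖ₑ ^ 2) * W := by
        gcongr with j hj
        have h1 : ‖b j‖ ≤ 2 * ‖a j‖ := by
          have h2 := hκhalf j hj
          rw [hb]
          simp only [norm_div]
          rw [div_le_iff₀ (by linarith)]
          nlinarith [norm_nonneg (a j)]
        have h2 : ‖b j‖ₑ ≤ 2 * ‖a j‖ₑ := by
          rw [← ofReal_norm, ← ofReal_norm, ← ENNReal.ofReal_ofNat,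
            ← ENNReal.ofReal_mul (by norm_num)]
          exact ENNReal.ofReal_le_ofReal h1
        calc ‖b j‖ₑ ^ 2 ≤ (2 * ‖a j‖ₑ) ^ 2 := by gcongr
          _ = 4 * ‖a j‖ₑ ^ 2 := by rw [mul_pow]; norm_num
    _ = 4 * W * ∑ j ∈ T, ‖a j‖ₑ ^ 2 := by
        rw [← Finset.mul_sum]; ring

/-- The operator norm of the extension operator is bounded by that of its adjoint. -/
theorem extensionNorm_le_of_dual {d : ℕ} (σ : Measure (EuclideanSpace ℝ (Fin d)))
    [IsFiniteMeasure σ] (X : Set (EuclideanSpace ℝ (Fin d))) (K : ℝ≥0∞)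
    (h : ∀ (T : Finset X) (a : X → ℂ),
      ∫⁻ ξ, ‖∑ x ∈ T, a x * unitExp (inner ℝ (x : EuclideanSpace ℝ (Fin d)) ξ)‖ₑ ^ 2 ∂σ ≤
        K * ∑ x ∈ T, ‖a x‖ₑ ^ 2) :
    extensionNorm σ X ≤ K ^ (1 / 2 : ℝ) := by
  refine iSup_le fun f => iSup_le fun hf => iSup_le fun hf1 => ?_
  unfold l2NormOn
  refine ENNReal.rpow_le_rpow ?_ (by norm_num)
  rw [ENNReal.tsum_eq_iSup_sum]
  refine iSup_le fun T => ?_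
  set Ef := fourierExtension σ f with hEf
  set A : ℝ≥0∞ := ∑ x ∈ T, ‖Ef x‖ₑ ^ 2 with hA
  -- The dual sum with coefficients conj(Ef(x)): pairing it with f gives A, whence A² ≤ K A by
  -- Cauchy–Schwarz, and the finite A cancels.
  set G : EuclideanSpace ℝ (Fin d) → ℂ := fun ξ => ∑ x ∈ T, (starRingEnd ℂ) (Ef x) *
    unitExp (inner ℝ (x : EuclideanSpace ℝ (Fin d)) ξ) with hG
  have hAtop : A ≠ ∞ := by
    rw [hA]
    exact ENNReal.sum_ne_top.2 fun x _ => ENNReal.pow_ne_top enorm_ne_top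
  have hue := continuous_unitExp
  have hf_int : Integrable f σ := hf.integrable (by norm_num)
  have hGcont : Continuous G := by rw [hG]; fun_prop
  have hterm : ∀ x : EuclideanSpace ℝ (Fin d),
      Integrable (fun ξ => f ξ * unitExp (inner ℝ x ξ)) σ := fun x =>
    hf_int.mul_bdd (c := 1) (Continuous.aestronglyMeasurable (by fun_prop))
      (Filter.Eventually.of_forall fun ξ => (norm_unitExp _).le)
  have hpair : ∫ ξ, f ξ * G ξ ∂σ = ((∑ x ∈ T, ‖Ef x‖ ^ 2 : ℝ) : ℂ) := by
    simp only [hG, Finset.mul_sum]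
    rw [integral_finsetSum]
    · push_cast
      refine Finset.sum_congr rfl fun x _ => ?_
      have : ∀ ξ, f ξ * ((starRingEnd ℂ) (Ef x) * unitExp (inner ℝ (x : EuclideanSpace ℝ (Fin d)) ξ))
          = (starRingEnd ℂ) (Ef x) * (f ξ * unitExp (inner ℝ (x : EuclideanSpace ℝ (Fin d)) ξ)) :=
        fun ξ => by ring
      simp only [this]
      rw [integral_const_mul, ← Complex.conj_mul']
      rfl
    · intro x _
      refine ((hterm x).const_mul ((starRingEnd ℂ) (Ef x))).congr
        (Filter.Eventually.of_forall fun ξ => ?_)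
      simp only; ring
  have hAeq : A = ‖∫ ξ, f ξ * G ξ ∂σ‖ₑ := by
    rw [hpair, ← ofReal_norm, Complex.norm_real, Real.norm_eq_abs, abs_of_nonneg (by positivity),
      ENNReal.ofReal_sum_of_nonneg (fun _ _ => by positivity), hA]
    refine Finset.sum_congr rfl fun x _ => ?_
    rw [ENNReal.ofReal_pow (norm_nonneg _), ofReal_norm]
  have hf2 : ∫⁻ ξ, ‖f ξ‖ₑ ^ 2 ∂σ ≤ 1 := by
    rw [eLpNorm_eq_lintegral_rpow_enorm_toReal (by norm_num) (by norm_num)] at hf1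
    simp only [ENNReal.toReal_ofNat, ENNReal.rpow_two] at hf1
    have h1 := ENNReal.rpow_le_rpow hf1 (zero_le_two (α := ℝ))
    rw [← ENNReal.rpow_mul, ENNReal.one_rpow] at h1
    simpa using h1
  have hCS : A ^ 2 ≤ (∫⁻ ξ, ‖f ξ‖ₑ ^ 2 ∂σ) * ∫⁻ ξ, ‖G ξ‖ₑ ^ 2 ∂σ := by
    have h1 : A ≤ ∫⁻ ξ, ‖f ξ‖ₑ * ‖G ξ‖ₑ ∂σ := by
      rw [hAeq]
      refine (enorm_integral_le_lintegral_enorm _).trans (le_of_eq ?_)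
      simp only [enorm_mul]
    have h2 := ENNReal.lintegral_mul_le_Lp_mul_Lq σ Real.HolderConjugate.two_two
      (f := fun ξ => ‖f ξ‖ₑ) (g := fun ξ => ‖G ξ‖ₑ) hf.1.enorm
      hGcont.enorm.measurable.aemeasurable
    simp only [Pi.mul_apply, ENNReal.rpow_two] at h2
    calc A ^ 2 ≤ ((∫⁻ ξ, ‖f ξ‖ₑ ^ 2 ∂σ) ^ (1 / (2 : ℝ)) *
            (∫⁻ ξ, ‖G ξ‖ₑ ^ 2 ∂σ) ^ (1 / (2 : ℝ))) ^ 2 := pow_le_pow_left' (h1.trans h2) 2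
      _ = _ := by
        rw [mul_pow, ← ENNReal.rpow_natCast, ← ENNReal.rpow_natCast, ← ENNReal.rpow_mul,
          ← ENNReal.rpow_mul]
        norm_num
  have hGle := h T (fun x => (starRingEnd ℂ) (Ef x))
  have hnc : ∀ x : X, ‖(starRingEnd ℂ) (Ef x)‖ₑ = ‖Ef x‖ₑ := fun x => by
    rw [← ofReal_norm, RCLike.norm_conj, ofReal_norm]
  simp only [hnc] at hGle
  have hfinal : A * A ≤ K * A := by
    rw [← sq]
    calc A ^ 2 ≤ 1 * (K * A) := hCS.trans (mul_le_mul' hf2 hGle)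
      _ = K * A := one_mul _
  rcases eq_or_ne A 0 with h0 | h0
  · rw [h0]; exact zero_le
  · exact (ENNReal.mul_le_mul_iff_left h0 hAtop).1 hfinal

/-! ### Upper bound for the sphere -/

theorem latticeBox_coord {d : ℕ} {β R : ℝ} (hR : 0 < R) {x : EuclideanSpace ℝ (Fin d)}
    (hx : x ∈ latticeBox d β R) : ∃ m : Fin d → ℤ, ∀ i, x i = m i * latticeStep d (R ^ β) i := by
  choose m hm using hx.1
  refine ⟨m, fun i => ?_⟩
  rw [hm i, latticeStep, mul_comm 2 β, Real.rpow_mul hR.le, Real.rpow_two]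

/-- The upper bound for the sphere. -/
theorem extensionNorm_sphere_le (n : ℕ) {ε : ℝ} (hε : 0 < ε) :
    ∃ C : ℝ, 0 < C ∧ ∀ β R : ℝ, 0 ≤ β → β ≤ 1 / 200 → 1 < R →
      extensionNorm (sphereMeasure (n + 2)) (latticeBox (n + 2) β R) ≤
        ENNReal.ofReal (C * R ^ ((1 / 2 : ℝ) - (3 / 2 : ℝ) * β + ε)) := by
  -- The count bounds the square of the norm, hence 2ε.
  obtain ⟨C, hC, hcount⟩ := exists_tsum_sphereMeasure_cube_le n (ε := 2 * ε) (by positivity)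
  set C' : ℝ := 4 * C * (8 * (n + 2)) / 2 ^ (n + 2) with hC'
  have hC'pos : 0 < C' := by positivity
  refine ⟨C' ^ (1 / 2 : ℝ), by positivity, fun β R hβ0 hβ hR => ?_⟩
  have hRpos : 0 < R := by linarith
  set N : ℝ := R ^ β with hN
  have hN1 : 1 ≤ N := Real.one_le_rpow hR.le hβ0
  have hNpos : 0 < N := by linarith
  have hNR : N ^ 200 ≤ R := by
    rw [hN, ← Real.rpow_natCast, ← Real.rpow_mul hRpos.le]
    calc R ^ (β * (200 : ℕ)) ≤ R ^ (1 : ℝ) :=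
          Real.rpow_le_rpow_of_exponent_le hR.le (by push_cast; linarith)
      _ = R := Real.rpow_one R
  -- Each of the n + 2 coordinates contributes at most rR to a phase, so the total is at most 1/8.
  set r : ℝ := 1 / (8 * (n + 2) * R) with hr
  have hrpos : 0 < r := by positivity
  have hrR : r ≤ 1 / R := by
    rw [hr]
    gcongr
    have : (0 : ℝ) ≤ n := Nat.cast_nonneg n
    nlinarith
  set X := latticeBox (n + 2) β R with hX
  set s := latticeStep (n + 2) N with hs
  have hspos : ∀ i, 0 < s i := fun i => latticeStep_pos hNpos i
  choose m hm using fun x : X => latticeBox_coord hRpos x.2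
  have hminj : Function.Injective m := by
    intro x y hxy
    ext i
    rw [hm x i, hm y i, hxy]
  set V : ℝ := ∏ i, 2 * (r * s i) with hV
  have hVval : V = (2 * r) ^ (n + 2) * N ^ (n + 3) := by
    rw [hV]
    simp only [← mul_assoc]
    rw [Finset.prod_mul_distrib, hs, prod_latticeStep]
    simp
  have hVpos : 0 < V := by rw [hVval]; positivity
  -- Since V = (2r)^{n+2} N^{n+3}, this is a constant times R N^{-3} R^{2ε}.
  set K : ℝ := 4 * (C * r ^ (n + 1) * N ^ n * R ^ (2 * ε)) / V with hK
  have hdual : extensionNorm (sphereMeasure (n + 2)) X ≤ ENNReal.ofReal K ^ (1 / 2 : ℝ) := by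
    refine extensionNorm_le_of_dual _ _ _ fun T a => ?_
    have h := lintegral_trigPoly_le T m hminj.injOn a s hspos hrpos (sphereMeasure (n + 2)) ?_
      (fun u hu => hcount N R r u hN1 hNR hrpos hrR hu)
    · have hinner : ∀ (x : X) (ξ : EuclideanSpace ℝ (Fin (n + 2))),
          inner ℝ (x : EuclideanSpace ℝ (Fin (n + 2))) ξ = ∑ i, m x i * (s i * ξ i) := by
        intro x ξ
        rw [PiLp.inner_apply]
        refine Finset.sum_congr rfl fun i _ => ?_
        rw [hm x i]
        simp only [RCLike.inner_apply, conj_trivial]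
        ring
      simp only [hinner]
      refine (ENNReal.mul_le_mul_iff_right (ENNReal.ofReal_pos.2 hVpos).ne'
        ENNReal.ofReal_ne_top).1 (h.trans (le_of_eq ?_))
      rw [← mul_assoc, ← ENNReal.ofReal_mul hVpos.le, hK, mul_div_cancel₀ _ hVpos.ne',
        ENNReal.ofReal_mul (p := 4) (by norm_num), ENNReal.ofReal_ofNat]
    · intro x _ v hv
      calc |∑ i, m x i * v i| ≤ ∑ i, |m x i * v i| := Finset.abs_sum_le_sum_abs _ _
        _ ≤ ∑ _i : Fin (n + 2), r * R := by
            refine Finset.sum_le_sum fun i _ => ?_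
            have h1 : |(m x i : ℝ)| * s i ≤ R := by
              have := x.2.2 i
              rwa [hm x i, abs_mul, abs_of_pos (hspos i)] at this
            rw [abs_mul]
            calc |(m x i : ℝ)| * |v i| ≤ |(m x i : ℝ)| * (r * s i) := by gcongr; exact hv i
              _ = r * (|(m x i : ℝ)| * s i) := by ring
              _ ≤ r * R := by gcongr
        _ = 1 / 8 := by
            rw [Finset.sum_const, Finset.card_univ, Fintype.card_fin, nsmul_eq_mul, hr]
            push_cast
            field_simp
  refine hdual.trans (le_of_eq ?_)
  have hKval : K = C' * (R ^ ((1 / 2 : ℝ) - (3 / 2 : ℝ) * β + ε)) ^ 2 := by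
    have hpow : (R ^ ((1 / 2 : ℝ) - (3 / 2 : ℝ) * β + ε)) ^ 2 = R * R ^ (2 * ε) / N ^ 3 := by
      rw [hN, ← Real.rpow_natCast, ← Real.rpow_natCast, ← Real.rpow_mul hRpos.le,
        ← Real.rpow_mul hRpos.le, eq_div_iff (by positivity), ← Real.rpow_add hRpos]
      nth_rewrite 2 [← Real.rpow_one R]
      rw [← Real.rpow_add hRpos]
      congr 1; push_cast; ring
    have hRr : 8 * (n + 2) * R = 1 / r := by rw [hr, one_div_one_div]
    have hCR : C' * (R * R ^ (2 * ε) / N ^ 3) =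
        4 * C / 2 ^ (n + 2) * (8 * (n + 2) * R) * (R ^ (2 * ε) / N ^ 3) := by
      rw [hC']; ring
    rw [hpow, hCR, hRr, hK, hVval, mul_pow]
    clear_value r
    field_simp
    ring
  rw [hKval, ENNReal.ofReal_rpow_of_nonneg (by positivity) (by norm_num),
    Real.mul_rpow hC'pos.le (by positivity), ← Real.rpow_natCast, ← Real.rpow_mul (by positivity)]
  norm_num

/-! ### Lower bound for the paraboloid -/

/-- If the phases `x · ξ` are almost integral for all `ξ ∈ P` and many `x ∈ X`, testing with the
indicator of `P` bounds the extension norm from below. -/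
theorem le_extensionNorm_of_re_unitExp {d : ℕ} (σ : Measure (EuclideanSpace ℝ (Fin d)))
    [IsFiniteMeasure σ] {X P : Set (EuclideanSpace ℝ (Fin d))} (hP : MeasurableSet P)
    {ι : Type*} (T : Finset ι) (φ : ι → EuclideanSpace ℝ (Fin d)) (hφ : Function.Injective φ)
    (hX : ∀ j ∈ T, φ j ∈ X)
    (hre : ∀ j ∈ T, ∀ ξ ∈ P, 1 / 2 ≤ (unitExp (inner ℝ (φ j) ξ)).re) :
    ENNReal.ofReal (T.card * (σ.real P / 4)) ^ (1 / 2 : ℝ) ≤ extensionNorm σ X := by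
  classical
  set p : ℝ := σ.real P with hp
  rcases (measureReal_nonneg : 0 ≤ σ.real P).eq_or_lt with h0 | hp0
  · rw [hp, ← h0]; simp
  rw [← hp] at hp0
  set q : ℝ := Real.sqrt p with hq
  have hq0 : 0 < q := Real.sqrt_pos.2 hp0
  have hqq : q * q = p := Real.mul_self_sqrt hp0.le
  -- The indicator of P, normalised in L². Without cancellation |Ef| is at least half of σ(P)^{1/2},
  -- hence the p / 4 below.
  set f : EuclideanSpace ℝ (Fin d) → ℂ := P.indicator fun _ => ((q⁻¹ : ℝ) : ℂ) with hf
  have hmem : MemLp f 2 σ := memLp_indicator_const 2 hP _ (Or.inr (measure_ne_top _ _))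
  have hnorm : eLpNorm f 2 σ ≤ 1 := by
    rw [hf, eLpNorm_indicator_const hP (by norm_num) (by norm_num), ← ofReal_norm,
      Complex.norm_real, Real.norm_eq_abs, abs_of_pos (by positivity),
      ← ofReal_measureReal (μ := σ) (s := P), ENNReal.ofReal_rpow_of_nonneg hp0.le (by norm_num),
      ← ENNReal.ofReal_mul (by positivity)]
    rw [ENNReal.toReal_ofNat, ← Real.sqrt_eq_rpow, ← hq, inv_mul_cancel₀ hq0.ne',
      ENNReal.ofReal_one]
  have hlow : ∀ j ∈ T, ENNReal.ofReal (p / 4) ≤ ‖fourierExtension σ f (φ j)‖ₑ ^ 2 := by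
    intro j hj
    have hval : fourierExtension σ f (φ j) =
        ((q⁻¹ : ℝ) : ℂ) * ∫ ξ in P, unitExp (inner ℝ (φ j) ξ) ∂σ := by
      rw [fourierExtension, ← integral_const_mul, ← integral_indicator hP]
      congr 1
      funext ξ
      by_cases h : ξ ∈ P
      · simp only [hf, Set.indicator_of_mem h]; rfl
      · simp only [hf, Set.indicator_of_notMem h, zero_mul]
    have hint : Integrable (fun ξ => unitExp (inner ℝ (φ j) ξ)) (σ.restrict P) := by
      have := continuous_unitExp
      refine Integrable.of_bound (C := 1) (Continuous.aestronglyMeasurable (by fun_prop))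
        (Filter.Eventually.of_forall fun v => ?_)
      rw [norm_unitExp]
    have h1 : p * (1 / 2) ≤ (∫ ξ in P, unitExp (inner ℝ (φ j) ξ) ∂σ).re := by
      have h2 := integral_re (𝕜 := ℂ) hint
      simp only [RCLike.re_to_complex] at h2
      have h3 : ∫ _v in P, (1 / 2 : ℝ) ∂σ = p * (1 / 2) := by
        rw [setIntegral_const, smul_eq_mul]
      rw [← h2, ← h3]
      exact setIntegral_mono_on (integrable_const _) hint.re hP fun ξ hξ => hre j hj ξ hξ
    have h4 : q / 2 ≤ ‖fourierExtension σ f (φ j)‖ := by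
      rw [hval, norm_mul, Complex.norm_real, Real.norm_eq_abs, abs_of_pos (by positivity),
        inv_mul_eq_div, le_div_iff₀ hq0]
      have := h1.trans (Complex.re_le_norm _)
      linarith
    rw [← ofReal_norm, ← ENNReal.ofReal_pow (norm_nonneg _)]
    apply ENNReal.ofReal_le_ofReal
    calc p / 4 = (q / 2) ^ 2 := by rw [← hqq]; ring
      _ ≤ _ := by gcongr
  refine le_trans ?_ (le_iSup_of_le f (le_iSup_of_le hmem (le_iSup_of_le hnorm le_rfl)))
  unfold l2NormOn
  refine ENNReal.rpow_le_rpow ?_ (by norm_num)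
  set ψ : {j // j ∈ T} → X := fun j => ⟨φ j.1, hX j.1 j.2⟩ with hψ
  have hψinj : Function.Injective ψ := fun a b hab => Subtype.ext (hφ (congrArg Subtype.val hab))
  calc ENNReal.ofReal (T.card * (p / 4)) = ∑ _x ∈ T.attach.image ψ, ENNReal.ofReal (p / 4) := by
        rw [Finset.sum_const, Finset.card_image_of_injective _ hψinj, Finset.card_attach,
          nsmul_eq_mul, ENNReal.ofReal_mul (Nat.cast_nonneg _), ENNReal.ofReal_natCast]
    _ ≤ ∑ x ∈ T.attach.image ψ, ‖fourierExtension σ f x‖ₑ ^ 2 := by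
        refine Finset.sum_le_sum fun x hx => ?_
        obtain ⟨j, -, rfl⟩ := Finset.mem_image.1 hx
        exact hlow j.1 j.2
    _ ≤ _ := ENNReal.sum_le_tsum _

/-- The graph parametrization `y ↦ (y, |y|²)` indexed by `Fin (n + 1)`. -/
noncomputable def graphMap (n : ℕ) (y : EuclideanSpace ℝ (Fin n)) : EuclideanSpace ℝ (Fin (n + 1)) :=
  WithLp.toLp 2 fun i : Fin (n + 1) => if h : (i : ℕ) < n then y ⟨i, h⟩ else ‖y‖ ^ 2

theorem graphMap_castSucc {n : ℕ} (y : EuclideanSpace ℝ (Fin n)) (i : Fin n) :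
    graphMap n y i.castSucc = y i := by simp [graphMap]

theorem graphMap_last {n : ℕ} (y : EuclideanSpace ℝ (Fin n)) :
    graphMap n y (Fin.last n) = ‖y‖ ^ 2 := by simp [graphMap]

theorem continuous_graphMap (n : ℕ) : Continuous (graphMap n) := by
  refine (PiLp.continuous_toLp 2 _).comp (continuous_pi fun i => ?_)
  split_ifs <;> fun_prop

theorem paraboloidMeasure_eq (n : ℕ) : paraboloidMeasure (n + 1) =
    (((volume : Measure (EuclideanSpace ℝ (Fin n))).restrict
    (Metric.closedBall 0 1)).withDensity
      fun y => ENNReal.ofReal (Real.sqrt (1 + 4 * ‖y‖ ^ 2))).map (graphMap n) := rfl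

instance isFiniteMeasure_paraboloidMeasure (n : ℕ) : IsFiniteMeasure (paraboloidMeasure (n + 1)) := by
  rw [paraboloidMeasure_eq]
  have : IsFiniteMeasure (((volume : Measure (EuclideanSpace ℝ (Fin n))).restrict
    (Metric.closedBall 0 1)).withDensity
      fun y => ENNReal.ofReal (Real.sqrt (1 + 4 * ‖y‖ ^ 2))) := by
    refine isFiniteMeasure_withDensity (ne_of_lt ?_)
    calc _ ≤ ∫⁻ _y in Metric.closedBall (0 : EuclideanSpace ℝ (Fin n)) 1,
          ENNReal.ofReal (Real.sqrt 5) := by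
          refine setLIntegral_mono' measurableSet_closedBall fun y hy => ?_
          apply ENNReal.ofReal_le_ofReal
          apply Real.sqrt_le_sqrt
          rw [mem_closedBall_zero_iff] at hy
          nlinarith [norm_nonneg y]
      _ < ∞ := by
          rw [setLIntegral_const]
          exact ENNReal.mul_lt_top ENNReal.ofReal_lt_top measure_closedBall_lt_top
  infer_instance

/-- The density √(1 + 4|y|²) is at least 1. -/
theorem volume_le_paraboloidMeasure {n : ℕ} {P : Set (EuclideanSpace ℝ (Fin (n + 1)))}
    (hP : MeasurableSet P) (hball : graphMap n ⁻¹' P ⊆ Metric.closedBall 0 1) :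
    volume (graphMap n ⁻¹' P) ≤ paraboloidMeasure (n + 1) P := by
  have hm := (continuous_graphMap n).measurable
  rw [paraboloidMeasure_eq, Measure.map_apply hm hP, withDensity_apply _ (hm hP)]
  calc volume (graphMap n ⁻¹' P)
      = ∫⁻ _y in graphMap n ⁻¹' P, 1 ∂(volume.restrict (Metric.closedBall 0 1)) := by
        rw [setLIntegral_one, Measure.restrict_apply (hm hP), Set.inter_eq_left.2 hball]
    _ ≤ _ := by
        refine lintegral_mono fun y => ?_
        rw [← ENNReal.ofReal_one]
        apply ENNReal.ofReal_le_ofReal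
        rw [Real.one_le_sqrt]
        nlinarith [sq_nonneg ‖y‖]

/-- Intervals of length `δ` to the right of the first `M + 1` points of `N⁻¹ℕ`. -/
def lacunarySet (N δ : ℝ) (M : ℕ) : Set ℝ :=
  ⋃ k ∈ Finset.range (M + 1), Set.Icc ((k : ℝ) / N) (k / N + δ)

theorem measurableSet_lacunarySet (N δ : ℝ) (M : ℕ) : MeasurableSet (lacunarySet N δ M) :=
  Finset.measurableSet_biUnion _ fun _ _ => measurableSet_Icc

theorem volume_lacunarySet {N δ : ℝ} (hN : 0 < N) (hδ : δ < 1 / N) (M : ℕ) :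
    volume (lacunarySet N δ M) = ENNReal.ofReal ((M + 1) * δ) := by
  rw [lacunarySet, measure_biUnion_finset]
  · simp only [Real.volume_Icc, add_sub_cancel_left, Finset.sum_const, Finset.card_range,
      nsmul_eq_mul]
    rw [ENNReal.ofReal_mul (by positivity), ← ENNReal.ofReal_natCast]
    push_cast; rfl
  · have key : ∀ k l : ℕ, k < l →
        Disjoint (Set.Icc ((k : ℝ) / N) (k / N + δ)) (Set.Icc ((l : ℝ) / N) (l / N + δ)) := by
      intro k l hkl
      rw [Set.disjoint_left]
      intro t ht ht'
      have h1 : (k : ℝ) / N + 1 / N ≤ l / N := by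
        rw [← add_div]; gcongr; exact_mod_cast hkl
      linarith [ht.2, ht'.1]
    intro k _ l _ hkl
    rcases lt_or_gt_of_ne hkl with h | h
    · exact key k l h
    · exact (key l k h).symm
  · exact fun _ _ => measurableSet_Icc

/-- The lower bound for the paraboloid. -/
theorem le_extensionNorm_paraboloid (n : ℕ) :
    ∃ C : ℝ, 0 < C ∧ ∀ β R : ℝ, 0 ≤ β → β ≤ 1 / 2 → 1 < R →
      ENNReal.ofReal (C * R ^ ((1 / 2 : ℝ) - β)) ≤
        extensionNorm (paraboloidMeasure (n + 2)) (latticeBox (n + 2) β R) := by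
  -- The factors come from the lattice count in [0, R/8]^d, from the mass of P relative to
  -- (N/R)^{n+1}, and from the 1/4 of the test function.
  set C' : ℝ := (1 / 8) ^ (n + 2) * (1 / (2 * (n + 1)) * (1 / (4 * (n + 1)))) ^ (n + 1) / 4 with hC'
  have hC'pos : 0 < C' := by positivity
  refine ⟨C' ^ (1 / 2 : ℝ), by positivity, fun β R hβ0 hβ hR => ?_⟩
  have hRpos : 0 < R := by linarith
  set N : ℝ := R ^ β with hN
  have hN1 : 1 ≤ N := Real.one_le_rpow hR.le hβ0
  have hNpos : 0 < N := by linarith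
  have hNR : N ≤ R := by
    calc N ≤ R ^ (1 : ℝ) := Real.rpow_le_rpow_of_exponent_le hR.le (by linarith)
      _ = R := Real.rpow_one R
  set s := latticeStep (n + 2) N with hs
  have hspos : ∀ i, 0 < s i := fun i => latticeStep_pos hNpos i
  have hs1 : ∀ i : Fin (n + 1), s i.castSucc = N := fun i => latticeStep_castSucc _
  have hs2 : s (Fin.last (n + 1)) = N ^ 2 := latticeStep_last
  -- Each of the n + 1 coordinates perturbs the phase by at most (R/8) · 4δ; the sum is 1/8.
  set δ : ℝ := 1 / (4 * (n + 1) * R) with hδ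
  have hδpos : 0 < δ := by positivity
  have hn0 : (0 : ℝ) ≤ n := Nat.cast_nonneg n
  have hδN : δ < 1 / N := by
    rw [hδ]; apply one_div_lt_one_div_of_lt hNpos; nlinarith
  have hδn : δ ≤ 1 / (4 * (n + 1)) := by
    rw [hδ]
    exact one_div_le_one_div_of_le (by positivity) (le_mul_of_one_le_right (by positivity) hR.le)
  -- With k ≤ M every coordinate stays below 1/(n+1), so P lies over the unit ball. The M + 1
  -- intervals include k = 0, so their number is at least N / (2(n+1)) even when the floor is 0.
  set M : ℕ := ⌊N / (2 * (n + 1))⌋₊ with hM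
  have hMle : (M : ℝ) ≤ N / (2 * (n + 1)) := Nat.floor_le (by positivity)
  have hMge : N / (2 * (n + 1)) ≤ M + 1 := (Nat.lt_floor_add_one _).le
  set U := lacunarySet N δ M with hU
  have hUmem : ∀ t ∈ U, ∃ k : ℕ, (k : ℝ) / N ≤ 1 / (2 * (n + 1)) ∧ (k : ℝ) / N ≤ t ∧
      t ≤ k / N + δ := by
    intro t ht
    simp only [hU, lacunarySet, Set.mem_iUnion, Finset.mem_range] at ht
    obtain ⟨k, hk, ht⟩ := ht
    refine ⟨k, ?_, ht.1, ht.2⟩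
    have : (k : ℝ) ≤ M := by exact_mod_cast Nat.lt_succ_iff.1 hk
    rw [div_le_iff₀ hNpos]
    calc (k : ℝ) ≤ N / (2 * (n + 1)) := this.trans hMle
      _ = _ := by ring
  set P : Set (EuclideanSpace ℝ (Fin (n + 2))) :=
    {ξ | (∀ i : Fin (n + 1), ξ i.castSucc ∈ U) ∧
      ξ (Fin.last (n + 1)) = ∑ i : Fin (n + 1), ξ i.castSucc ^ 2} with hP
  have hPm : MeasurableSet P := by
    refine MeasurableSet.inter ?_ ?_
    · have : {ξ : EuclideanSpace ℝ (Fin (n + 2)) | ∀ i : Fin (n + 1), ξ i.castSucc ∈ U} =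
          ⋂ i : Fin (n + 1), (fun ξ : EuclideanSpace ℝ (Fin (n + 2)) => ξ i.castSucc) ⁻¹' U := by
        ext; simp
      change MeasurableSet {ξ : EuclideanSpace ℝ (Fin (n + 2)) | ∀ i : Fin (n + 1), ξ i.castSucc ∈ U}
      rw [this]
      exact MeasurableSet.iInter fun i =>
        (by fun_prop : Measurable fun ξ : EuclideanSpace ℝ (Fin (n + 2)) => ξ i.castSucc)
          (measurableSet_lacunarySet N δ M)
    · exact measurableSet_eq_fun (by fun_prop) (by fun_prop)
  have hpre : graphMap (n + 1) ⁻¹' P =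
      (WithLp.ofLp : EuclideanSpace ℝ (Fin (n + 1)) → Fin (n + 1) → ℝ) ⁻¹'
        (Set.univ.pi fun _ => U) := by
    ext y
    simp only [hP, Set.mem_preimage, Set.mem_ofPred_eq, graphMap_castSucc, graphMap_last,
      EuclideanSpace.real_norm_sq_eq, and_true, Set.mem_univ_pi]
  have hvol : volume (graphMap (n + 1) ⁻¹' P) = ENNReal.ofReal (((M + 1) * δ) ^ (n + 1)) := by
    rw [hpre, (PiLp.volume_preserving_ofLp (Fin (n + 1))).measure_preimage
      (MeasurableSet.univ_pi fun _ => measurableSet_lacunarySet N δ M).nullMeasurableSet,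
      volume_pi_pi, volume_lacunarySet hNpos hδN]
    simp only [Finset.prod_const, Finset.card_univ, Fintype.card_fin]
    rw [ENNReal.ofReal_pow (by positivity)]
  have hball : graphMap (n + 1) ⁻¹' P ⊆ Metric.closedBall 0 1 := by
    intro y hy
    rw [hpre] at hy
    rw [mem_closedBall_zero_iff]
    have h1 : ∀ i, |y i| ≤ 1 / (n + 1) := by
      intro i
      obtain ⟨k, hk1, hk2, hk3⟩ := hUmem _ (hy i (Set.mem_univ i))
      have h0 : (0 : ℝ) ≤ k / N := by positivity
      rw [abs_of_nonneg (h0.trans hk2)]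
      calc y i ≤ 1 / (2 * (n + 1)) + 1 / (4 * (n + 1)) := by linarith
        _ ≤ 1 / (n + 1) := by
          rw [← sub_nonneg]
          have : 1 / ((n : ℝ) + 1) - (1 / (2 * (n + 1)) + 1 / (4 * (n + 1))) = 1 / (4 * (n + 1)) := by
            field_simp; norm_num
          rw [this]; positivity
    refine (norm_le_sqrt_mul_of_forall_abs_le (by positivity) h1).trans ?_
    push_cast
    rw [mul_one_div, div_le_one (by positivity)]
    rw [Real.sqrt_le_left (by positivity)]
    nlinarith
  have hσP : ((M + 1) * δ) ^ (n + 1) ≤ (paraboloidMeasure (n + 2)).real P := by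
    have h1 := volume_le_paraboloidMeasure hPm hball
    rw [hvol] at h1
    exact (ENNReal.ofReal_le_iff_le_toReal (measure_ne_top _ _)).1 h1
  set T : Finset (Fin (n + 2) → ℤ) :=
    Fintype.piFinset fun i => Finset.Icc 0 ⌊R / 8 / s i⌋ with hT
  set φ : (Fin (n + 2) → ℤ) → EuclideanSpace ℝ (Fin (n + 2)) :=
    fun m => WithLp.toLp 2 fun i => m i * s i with hφ
  have hφinj : Function.Injective φ := by
    intro m m' h
    funext i
    have h1 : (m i : ℝ) * s i = m' i * s i := congrArg (fun x : EuclideanSpace ℝ (Fin (n + 2)) => x i) h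
    exact_mod_cast mul_right_cancel₀ (hspos i).ne' h1
  have hTmem : ∀ m ∈ T, ∀ i, 0 ≤ (m i : ℝ) * s i ∧ (m i : ℝ) * s i ≤ R / 8 := by
    intro m hm i
    rw [hT, Fintype.mem_piFinset] at hm
    have h1 := Finset.mem_Icc.1 (hm i)
    refine ⟨mul_nonneg (by exact_mod_cast h1.1) (hspos i).le, ?_⟩
    rw [← le_div_iff₀ (hspos i)]
    exact Int.le_floor.1 h1.2
  -- Counting the origin, each coordinate has ⌊·⌋ + 1 choices, so the bound survives when the step
  -- N² exceeds R/8.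
  have hcard : (R / 8) ^ (n + 2) / N ^ (n + 3) ≤ T.card := by
    rw [hT, Fintype.card_piFinset]
    have : (R / 8) ^ (n + 2) / N ^ (n + 3) = ∏ i, R / 8 / s i := by
      rw [Finset.prod_div_distrib, hs, prod_latticeStep, Finset.prod_const, Finset.card_univ,
        Fintype.card_fin]
    rw [this]
    push_cast
    refine Finset.prod_le_prod (fun i _ => by have := hspos i; positivity) fun i _ => ?_
    have hfl : 0 ≤ ⌊R / 8 / s i⌋ := Int.floor_nonneg.2 (by have := hspos i; positivity)
    have h2 : (((Finset.Icc 0 ⌊R / 8 / s i⌋).card : ℤ) : ℝ) = ⌊R / 8 / s i⌋ + 1 := by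
      rw [Int.card_Icc, sub_zero, Int.toNat_of_nonneg (by omega)]
      push_cast; rfl
    rw [Int.cast_natCast] at h2
    rw [h2]
    exact (Int.lt_floor_add_one _).le
  have hX : ∀ m ∈ T, φ m ∈ latticeBox (n + 2) β R := by
    intro m hm
    refine ⟨fun i => ⟨m i, ?_⟩, fun i => ?_⟩
    · simp only [hφ, hs, latticeStep]
      rw [mul_comm 2 β, Real.rpow_mul hRpos.le, Real.rpow_two]
    · obtain ⟨h1, h2⟩ := hTmem m hm i
      simp only [hφ]
      rw [abs_of_nonneg h1]
      linarith
  have hre : ∀ m ∈ T, ∀ ξ ∈ P, 1 / 2 ≤ (unitExp (inner ℝ (φ m) ξ)).re := by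
    rintro m hm ξ ⟨hξ, hξl⟩
    choose k hk1 hk2 hk3 using fun i => hUmem _ (hξ i)
    set x : Fin (n + 2) → ℝ := fun i => m i * s i with hx
    have hx0 : ∀ i, 0 ≤ x i := fun i => (hTmem m hm i).1
    have hx1 : ∀ i, x i ≤ R / 8 := fun i => (hTmem m hm i).2
    set t : Fin (n + 1) → ℝ := fun i => ξ i.castSucc - k i / N with ht
    have ht0 : ∀ i, 0 ≤ t i := fun i => sub_nonneg.2 (hk2 i)
    have ht1 : ∀ i, t i ≤ δ := fun i => by simp only [ht]; linarith [hk3 i]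
    -- The resonance: at ξᵢ = kᵢ/N the phase is the integer ∑ (mᵢ kᵢ + m_last kᵢ²). What remains is
    -- linear and quadratic in the offsets tᵢ ∈ [0, δ].
    have hinner : inner ℝ (φ m) ξ =
        ((∑ i : Fin (n + 1), (m i.castSucc * k i + m (Fin.last (n + 1)) * k i ^ 2) : ℤ) : ℝ) +
        ∑ i : Fin (n + 1), (x i.castSucc * t i +
          x (Fin.last (n + 1)) * (t i * (2 * (k i / N) + t i))) := by
      rw [PiLp.inner_apply, Fin.sum_univ_castSucc, hξl]
      simp only [RCLike.inner_apply, conj_trivial, hφ]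
      rw [Finset.sum_mul, ← Finset.sum_add_distrib]
      push_cast
      rw [← Finset.sum_add_distrib]
      refine Finset.sum_congr rfl fun i _ => ?_
      simp only [hx, ht, hs1, hs2]
      field_simp
      ring
    rw [hinner, unitExp_add, unitExp_intCast, one_mul]
    apply re_unitExp_ge
    have hterm : ∀ i : Fin (n + 1), 0 ≤ x i.castSucc * t i +
          x (Fin.last (n + 1)) * (t i * (2 * (k i / N) + t i)) ∧ x i.castSucc * t i +
          x (Fin.last (n + 1)) * (t i * (2 * (k i / N) + t i)) ≤ R / 8 * (4 * δ) := by
      intro i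
      have h0 : (0 : ℝ) ≤ k i / N := by positivity
      have hkN : (k i : ℝ) / N ≤ 1 := (hk1 i).trans (by rw [div_le_one (by positivity)]; linarith)
      have hδ1 : δ ≤ 1 := hδn.trans (by rw [div_le_one (by positivity)]; linarith)
      have h3 : 0 ≤ 2 * ((k i : ℝ) / N) + t i := by linarith [ht0 i]
      have h4 : 2 * ((k i : ℝ) / N) + t i ≤ 3 := by linarith [ht1 i]
      have h5 := hx0 i.castSucc
      have h6 := hx0 (Fin.last (n + 1))
      have h7 := ht0 i
      refine ⟨by positivity, ?_⟩
      have e1 : x i.castSucc * t i ≤ R / 8 * δ := by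
        gcongr
        · exact hx1 _
        · exact ht1 i
      have e2 : x (Fin.last (n + 1)) * (t i * (2 * (k i / N) + t i)) ≤ R / 8 * (δ * 3) := by
        gcongr
        · exact hx1 _
        · exact ht1 i
      linarith
    rw [abs_of_nonneg (Finset.sum_nonneg fun i _ => (hterm i).1)]
    calc _ ≤ ∑ _i : Fin (n + 1), R / 8 * (4 * δ) := Finset.sum_le_sum fun i _ => (hterm i).2
      _ = 1 / 8 := by
        rw [Finset.sum_const, Finset.card_univ, Fintype.card_fin, nsmul_eq_mul, hδ]
        push_cast
        field_simp
  refine le_trans ?_ (le_extensionNorm_of_re_unitExp (paraboloidMeasure (n + 2)) hPm T φ hφinj hX hre)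
  have hpow : (R ^ ((1 / 2 : ℝ) - β)) ^ 2 = R / N ^ 2 := by
    rw [hN, ← Real.rpow_natCast, ← Real.rpow_natCast, ← Real.rpow_mul hRpos.le,
      ← Real.rpow_mul hRpos.le, eq_div_iff (by positivity), ← Real.rpow_add hRpos]
    nth_rewrite 2 [← Real.rpow_one R]
    congr 1; push_cast; ring
  have hmain : C' * (R ^ ((1 / 2 : ℝ) - β)) ^ 2 ≤
      T.card * ((paraboloidMeasure (n + 2)).real P / 4) := by
    calc C' * (R ^ ((1 / 2 : ℝ) - β)) ^ 2
        = (R / 8) ^ (n + 2) / N ^ (n + 3) * ((N / (2 * (n + 1)) * δ) ^ (n + 1) / 4) := by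
          have e1 : N / (2 * (n + 1)) * δ =
              N / R * (1 / (2 * (n + 1)) * (1 / (4 * (n + 1)))) := by rw [hδ]; field_simp
          rw [hpow, hC', e1]
          generalize 1 / (2 * ((n : ℝ) + 1)) * (1 / (4 * (n + 1))) = w
          simp only [div_pow, mul_pow, one_pow]
          field_simp
          ring
      _ ≤ _ := by
          gcongr
          refine le_trans ?_ hσP
          gcongr
  have hsq : C' ^ (1 / 2 : ℝ) * R ^ ((1 / 2 : ℝ) - β) =
      (C' * (R ^ ((1 / 2 : ℝ) - β)) ^ 2) ^ (1 / 2 : ℝ) := by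
    rw [Real.mul_rpow hC'pos.le (by positivity), ← Real.rpow_natCast (R ^ ((1 / 2 : ℝ) - β)) 2,
      ← Real.rpow_mul (by positivity)]
    norm_num
  rw [hsq, ← ENNReal.ofReal_rpow_of_nonneg (by positivity) (by norm_num)]
  exact ENNReal.rpow_le_rpow (ENNReal.ofReal_le_ofReal hmain) (by norm_num)

/-! ### The two bounds combined -/

theorem theorem4 :
    (∃ c : ℝ, 0 < c ∧ ∀ d : ℕ, 2 ≤ d → ∀ ε : ℝ, 0 < ε → ∃ C : ℝ, 0 < C ∧
      ∀ β : ℝ, 0 ≤ β → β ≤ c / (d : ℝ) ^ 2 → ∀ R : ℝ, 1 < R →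
        extensionNorm (sphereMeasure d) (latticeBox d β R) ≤
          ENNReal.ofReal (C * R ^ ((1 / 2 : ℝ) - (3 / 2 : ℝ) * β + ε))) ∧
    (∀ d : ℕ, 2 ≤ d → ∃ C : ℝ, 0 < C ∧
      ∀ β : ℝ, 0 ≤ β → β ≤ 1 / 2 → ∀ R : ℝ, 1 < R →
        ENNReal.ofReal (C * R ^ ((1 / 2 : ℝ) - β)) ≤
          extensionNorm (paraboloidMeasure d) (latticeBox d β R)) := by
  constructor
  · refine ⟨1 / 200, by norm_num, fun d hd ε hε => ?_⟩
    obtain ⟨n, rfl⟩ : ∃ n, d = n + 2 := ⟨d - 2, by omega⟩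
    obtain ⟨C, hC, h⟩ := extensionNorm_sphere_le n hε
    refine ⟨C, hC, fun β hβ0 hβ R hR => h β R hβ0 (hβ.trans ?_) hR⟩
    refine div_le_self (by norm_num) (one_le_pow₀ ?_)
    push_cast
    linarith [(Nat.cast_nonneg n : (0 : ℝ) ≤ n)]
  · intro d hd
    obtain ⟨n, rfl⟩ : ∃ n, d = n + 2 := ⟨d - 2, by omega⟩
    obtain ⟨C, hC, h⟩ := le_extensionNorm_paraboloid n
    exact ⟨C, hC, fun β hβ0 hβ R hR => h β R hβ0 hβ hR⟩
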